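/- Let $n\ge 1$, let $B^n$ and $S^{n-1}$ be the Euclidean unit ball and unit sphere of $\mathbb{R}^n$, and let $du$ be the spherical measure on $S^{n-1}$. Let $\mathcal{K}_{(o)}^n$ be the set of compact convex sets in $\mathbb{R}^n$ with the origin in their interior. For $K\in\mathcal{K}_{(o)}^n$ write $h_K(u)=\max_{x\in K}\langle x,u\rangle$ and $\rho_K(u)=\max\{t\ge 0: tu\in K\}$ ($u\in S^{n-1}$), and $K^\circ=\{x:\langle x,y\rangle\le 1 \text{ for all } y\in K\}$. Let $G:(0,\infty)\times S^{n-1}\to(0,\infty)$ be continuous and such that, for each $u\in S^{n-1}$, $G(\cdot,u)$ is strictly increasing with $\lim_{t\to0^+}G(t,u)=0$ and $\lim_{t\to\infty}G(t,u)=\infty$. Suppose that $\inf\{G(t,u)/t^{q}: t\ge 1,\ u\in S^{n-1}\}>0$ for some $q\ge n-1$. Put $$\widetilde V_G(K)=\int_{S^{n-1}}G(\rho_K(u),u)\,du,\qquad \widehat V_G(K)=\inf\Big\{\eta>0:\int_{S^{n-1}}G\Big(\frac{\rho_K(u)}{\eta},u\Big)du\le 1\Big\},$$ $$\widetilde{\mathcal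 B}=\{Q\in\mathcal{K}_{(o)}^n:\widetilde V_G(Q^\circ)=\widetilde V_G(B^n)\},\qquad \widehat{\mathcal B}=\{Q\in\mathcal{K}_{(o)}^n:\widehat V_G(Q^\circ)=\widehat V_G(B^n)\}.$$ Let $\varphi:(0,\infty)\to(0,\infty)$ be continuous and strictly increasing with $\lim_{t\to0^+}\varphi(t)=0$, $\varphi(1)=1$, $\lim_{t\to\infty}\varphi(t)=\infty$. For a nonzero finite Borel measure $\nu$ on $S^{n-1}$ and $Q\in\mathcal{K}_{(o)}^n$ put $$\|h_Q\|_{\nu,\varphi}=\inf\Big\{\lambda>0:\frac1{\nu(S^{n-1})}\int_{S^{n-1}}\varphi\Big(\frac{h_Q(u)}{\lambda}\Big)d\nu(u)\le 1\Big\}.$$ Let $\mu$ and $\mu_i$ ($i\in\mathbb N$) be finite Borel measures on $S^{n-1}$, none of them concentrated on a closed hemisphere $\{u\in S^{n-1}:\langle u,v\rangle\le0\}$ ($v\in S^{n-1}$), with $\mu_i\to\mu$ weakly. Then: i) Suppose that $\widetilde M_i\in\widetilde{\mathcal B}$ attains $\inf\{\|h_Q\|_{\mu_i,\varphi}:Q\in\widetilde{\mathcal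 B}\}$ for each $i\in\mathbb N$, and that $\widetilde M\in\widetilde{\mathcal B}$ attains $\inf\{\|h_Q\|_{\mu,\varphi}:Q\in\widetilde{\mathcal B}\}$. Then $\lim_{i\to\infty}\|h_{\widetilde M_i}\|_{\mu_i,\varphi}=\|h_{\widetilde M}\|_{\mu,\varphi}$. If, in addition, $\varphi$ and $G(\cdot,u)$, for every $u\in S^{n-1}$, are convex on $(0,\infty)$, then $\widetilde M_i\to\widetilde M$ in the Hausdorff metric. ii) Suppose that $\widehat M_i\in\widehat{\mathcal B}$ attains $\inf\{\|h_Q\|_{\mu_i,\varphi}:Q\in\widehat{\mathcal B}\}$ for each $i\in\mathbb N$, and that $\widehat M\in\widehat{\mathcal B}$ attains $\inf\{\|h_Q\|_{\mu,\varphi}:Q\in\widehat{\mathcal B}\}$. Then $\lim_{i\to\infty}\|h_{\widehat M_i}\|_{\mu_i,\varphi}=\|h_{\widehat M}\|_{\mu,\varphi}$. If, in addition, $\varphi$ and $G(\cdot,u)$, for every $u\in S^{n-1}$, are convex on $(0,\infty)$, then $\widehat M_i\to\widehat M$ in the Hausdorff metric. -/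

import Mathlib

open Filter Topology MeasureTheory

noncomputable section

namespace DualPolarOrlicz

/-- The Euclidean space `ℝⁿ`. -/
abbrev Euc (n : ℕ) : Type := EuclideanSpace ℝ (Fin n)

/-- The unit sphere `S^{n-1}` of `ℝⁿ`. -/
abbrev Sph (n : ℕ) : Type := Metric.sphere (0 : Euc n) 1

/-- The spherical measure `du` on `S^{n-1}` (surface area measure, not normalized). -/
abbrev sphericalMeasure (n : ℕ) : Measure (Sph n) := (volume : Measure (Euc n)).toSphere

/-- The support function `h_K(u) = max_{x ∈ K} ⟨x, u⟩`. -/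
def supportFun {n : ℕ} (K : Set (Euc n)) (u : Sph n) : ℝ :=
  sSup ((fun x : Euc n => inner ℝ x (u : Euc n)) '' K)

/-- The radial function `ρ_K(u) = max {t ≥ 0 : t u ∈ K}`. -/
def radialFun {n : ℕ} (K : Set (Euc n)) (u : Sph n) : ℝ :=
  sSup {t : ℝ | 0 ≤ t ∧ t • (u : Euc n) ∈ K}

/-- The polar set `K° = {x : ⟨x, y⟩ ≤ 1 for all y ∈ K}`. -/
def polarSet {n : ℕ} (K : Set (Euc n)) : Set (Euc n) :=
  {x | ∀ y ∈ K, inner ℝ x y ≤ 1}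

/-- The convex bodies of `ℝⁿ` with the origin in their interiors. Mathlib's `ConvexBody` is the
type of nonempty compact convex sets, with the Hausdorff metric. -/
def bodiesAroundOrigin (n : ℕ) : Set (ConvexBody (Euc n)) :=
  {K | (0 : Euc n) ∈ interior (K : Set (Euc n))}

/-- The class `𝒢_I`: continuous functions `G : (0, ∞) × S^{n-1} → (0, ∞)`, strictly increasing in
the first variable, with limit `0` at `0+` and limit `∞` at `∞`. Only the values `G t u` with
`t > 0` are meaningful. -/
structure ClassGI {n : ℕ} (G : ℝ → Sph n → ℝ) : Prop where
  continuousOn : ContinuousOn (fun p : ℝ × Sph n => G p.1 p.2) (Set.Ioi 0 ×ˢ Set.univ)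
  pos : ∀ t : ℝ, 0 < t → ∀ u, 0 < G t u
  strictMonoOn : ∀ u, StrictMonoOn (fun t => G t u) (Set.Ioi 0)
  tendsto_zero : ∀ u, Tendsto (fun t => G t u) (𝓝[>] 0) (𝓝 0)
  tendsto_atTop : ∀ u, Tendsto (fun t => G t u) atTop atTop

/-- The class `ℐ`: continuous strictly increasing functions `φ : (0, ∞) → (0, ∞)` with
`φ(0+) = 0`, `φ(1) = 1` and `φ(∞) = ∞`. Only the values on `(0, ∞)` are meaningful. -/
structure ClassI (φ : ℝ → ℝ) : Prop where
  continuousOn : ContinuousOn φ (Set.Ioi 0)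
  pos : ∀ t : ℝ, 0 < t → 0 < φ t
  strictMonoOn : StrictMonoOn φ (Set.Ioi 0)
  tendsto_zero : Tendsto φ (𝓝[>] 0) (𝓝 0)
  map_one : φ 1 = 1
  tendsto_atTop : Tendsto φ atTop atTop

/-- The growth condition `inf {G(t, u) / t^q : t ≥ 1, u ∈ S^{n-1}} > 0`. -/
def GrowthCondition {n : ℕ} (G : ℝ → Sph n → ℝ) (q : ℝ) : Prop :=
  0 < sInf {x : ℝ | ∃ t : ℝ, ∃ u : Sph n, 1 ≤ t ∧ x = G t u / t ^ q}

/-- The general dual volume `Ṽ_G(K) = ∫ G(ρ_K(u), u) du`. -/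
def dualVolume {n : ℕ} (G : ℝ → Sph n → ℝ) (K : Set (Euc n)) : ℝ :=
  ∫ u, G (radialFun K u) u ∂(sphericalMeasure n)

/-- The homogeneous general dual volume `V̂_G(K)`, for `G` increasing in its first variable. -/
def homDualVolume {n : ℕ} (G : ℝ → Sph n → ℝ) (K : Set (Euc n)) : ℝ :=
  sInf {η : ℝ | 0 < η ∧ ∫ u, G (radialFun K u / η) u ∂(sphericalMeasure n) ≤ 1}

/-- The bodies `Q` with the origin in their interiors and `Ṽ_G(Q°) = Ṽ_G(Bⁿ)`. -/
def tildeB {n : ℕ} (G : ℝ → Sph n → ℝ) : Set (ConvexBody (Euc n)) :=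
  {Q | Q ∈ bodiesAroundOrigin n ∧
    dualVolume G (polarSet (Q : Set (Euc n))) = dualVolume G (Metric.closedBall 0 1)}

/-- The bodies `Q` with the origin in their interiors and `V̂_G(Q°) = V̂_G(Bⁿ)`. -/
def hatB {n : ℕ} (G : ℝ → Sph n → ℝ) : Set (ConvexBody (Euc n)) :=
  {Q | Q ∈ bodiesAroundOrigin n ∧
    homDualVolume G (polarSet (Q : Set (Euc n))) = homDualVolume G (Metric.closedBall 0 1)}

/-- The Orlicz norm `‖h_Q‖_{μ,φ}` of the support function of `Q`, for increasing `φ`. -/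
def orliczNorm {n : ℕ} (μ : FiniteMeasure (Sph n)) (φ : ℝ → ℝ) (Q : ConvexBody (Euc n)) : ℝ :=
  sInf {l : ℝ | 0 < l ∧
    (1 / (μ.mass : ℝ)) *
      ∫ u, φ (supportFun (Q : Set (Euc n)) u / l) ∂(μ : Measure (Sph n)) ≤ 1}

/-- `μ` is not concentrated on any closed hemisphere `{u : ⟨u, v⟩ ≤ 0}`, `v ∈ S^{n-1}`: the
complement of each closed hemisphere has positive measure. -/
def NotConcentratedOnHemisphere {n : ℕ} (μ : FiniteMeasure (Sph n)) : Prop :=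
  ∀ v : Sph n, 0 < (μ : Measure (Sph n)) {u | inner ℝ (u : Euc n) (v : Euc n) ≤ 0}ᶜ

/-- `M` solves `inf {‖h_Q‖_{μ,φ} : Q ∈ B}`: it lies in `B` and attains the infimum. -/
def IsSolution {n : ℕ} (μ : FiniteMeasure (Sph n)) (φ : ℝ → ℝ) (B : Set (ConvexBody (Euc n)))
    (M : ConvexBody (Euc n)) : Prop :=
  M ∈ B ∧ ∀ Q ∈ B, orliczNorm μ φ M ≤ orliczNorm μ φ Q

end DualPolarOrlicz

end

/-! Both variational problems have one form. Since `ρ_{Q°} = 1 / h_Q`, the class `tildeB` is a level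
set of `Q ↦ ∫ G(1 / h_Q(u), u) du`. A modular in `ClassGI` decreases strictly and continuously in
the scaling parameter, so its Luxemburg functional equals `η` exactly when the modular at `η` is 1;
hence `hatB` is such a level set too, for `G(t / η, u)` with `η = V̂_G(Bⁿ)`. It suffices to treat
`polarLevel G C`.

The argument is compactness plus uniqueness. Using the solution `M` for `μ` as a competitor for each
`μ_i` bounds the optimal norms. Because `μ` charges every open hemisphere, such a bound keeps a
subsequence of the bodies bounded (`exists_frequently_norm_le`), and Blaschke selection gives a
limit `L`. The danger is that the origin reaches the boundary of `L`. Then `h_i(v) → 0` for some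
`v`, and the equi-Lipschitz bound on `h_i` makes `1 / h_i` at least of order `1 / r` on the cap of
radius `r` about `v`; growth of order `q ≥ n - 1` is just enough to contradict the fixed dual volume
(`not_bounded_of_tendsto_zero`). So `L` is admissible, and joint continuity of the norm in measure
and body makes it optimal with value `‖h_M‖`.

Under convexity the midpoint of two distinct solutions can be shrunk to an admissible body of
smaller norm (`solution_unique`), so every subsequential limit is `M`. -/

namespace DualPolarOrlicz

variable {n : ℕ}

/-! ### Modulars and Luxemburg functionals on the sphere -/

/-- The modular `∫ H(f(u)/η, u) dν(u)`. -/
noncomputable def luxInt (ν : Measure (Sph n)) (H : ℝ → Sph n → ℝ) (f : Sph n → ℝ) (η : ℝ) : ℝ :=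
  ∫ u, H (f u / η) u ∂ν

/-- The Luxemburg functional associated with the modular `luxInt`. -/
noncomputable def lux (ν : Measure (Sph n)) (H : ℝ → Sph n → ℝ) (f : Sph n → ℝ) : ℝ :=
  sInf {η : ℝ | 0 < η ∧ luxInt ν H f η ≤ 1}

theorem exists_pos_le_of_continuous {f : Sph n → ℝ} (hf : Continuous f) (hpos : ∀ u, 0 < f u) :
    ∃ m, 0 < m ∧ ∀ u, m ≤ f u := by
  rcases isEmpty_or_nonempty (Sph n) with h | h
  · exact ⟨1, one_pos, fun u => h.elim u⟩
  · obtain ⟨u0, -, h0⟩ := isCompact_univ.exists_isMinOn Set.univ_nonempty hf.continuousOn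
    exact ⟨f u0, hpos _, fun u => h0 (Set.mem_univ u)⟩

namespace ClassGI

variable {H : ℝ → Sph n → ℝ} (hH : ClassGI H)
include hH

theorem continuous_comp {X : Type*} [TopologicalSpace X] {f : X → ℝ} {g : X → Sph n}
    (hf : Continuous f) (hg : Continuous g) (hpos : ∀ x, 0 < f x) :
    Continuous fun x => H (f x) (g x) :=
  hH.continuousOn.comp_continuous (hf.prodMk hg) fun x => ⟨hpos x, trivial⟩

theorem integrable (ν : Measure (Sph n)) [IsFiniteMeasure ν] {f : Sph n → ℝ} (hf : Continuous f)
    (hpos : ∀ u, 0 < f u) : Integrable (fun u => H (f u) u) ν :=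
  (hH.continuous_comp hf continuous_id hpos).integrable_of_hasCompactSupport
    (HasCompactSupport.of_compactSpace _)

theorem mono {s t : ℝ} (hs : 0 < s) (hst : s ≤ t) (u : Sph n) : H s u ≤ H t u :=
  (hH.strictMonoOn u).monotoneOn hs (hs.trans_le hst) hst

/-- Compactness makes the pointwise limit uniform in `u`: the open sets `{u | c < H (k + 1) u}`
increase with `k` and cover the sphere. `exists_forall_lt` is the same argument at `0`. -/
theorem exists_forall_gt (c : ℝ) : ∃ T : ℝ, 0 < T ∧ ∀ u, c < H T u := by
  obtain ⟨k, hk⟩ := isCompact_univ.elim_directed_cover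
    (fun k : ℕ => {u : Sph n | c < H (k + 1) u})
    (fun k => isOpen_lt continuous_const
      (hH.continuous_comp continuous_const continuous_id fun _ => by positivity))
    (fun u _ => by
      have h1 : Tendsto (fun k : ℕ => H ((k : ℝ) + 1) u) atTop atTop :=
        (hH.tendsto_atTop u).comp
          (tendsto_atTop_add_const_right _ _ tendsto_natCast_atTop_atTop)
      obtain ⟨k, hk⟩ := (h1.eventually_gt_atTop c).exists
      exact Set.mem_iUnion.2 ⟨k, hk⟩)
    (Monotone.directed_le fun k l hkl u (hu : c < _) => show c < _ from
      hu.trans_le (hH.mono (by positivity) (by gcongr) u))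
  exact ⟨k + 1, by positivity, fun u => hk (Set.mem_univ u)⟩

theorem exists_forall_lt {c : ℝ} (hc : 0 < c) : ∃ T : ℝ, 0 < T ∧ ∀ u, H T u < c := by
  obtain ⟨k, hk⟩ := isCompact_univ.elim_directed_cover
    (fun k : ℕ => {u : Sph n | H (1 / ((k : ℝ) + 1)) u < c})
    (fun k => isOpen_lt
      (hH.continuous_comp continuous_const continuous_id fun _ => by positivity) continuous_const)
    (fun u _ => by
      have h0 : Tendsto (fun k : ℕ => 1 / ((k : ℝ) + 1)) atTop (𝓝[>] 0) :=
        tendsto_nhdsWithin_iff.2 ⟨tendsto_one_div_add_atTop_nhds_zero_nat,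
          Eventually.of_forall fun k => by simp only [Set.mem_Ioi]; positivity⟩
      obtain ⟨k, hk⟩ := (((hH.tendsto_zero u).comp h0).eventually_lt_const hc).exists
      exact Set.mem_iUnion.2 ⟨k, hk⟩)
    (Monotone.directed_le fun k l hkl u (hu : _ < c) => show _ < c from
      (hH.mono (by positivity) (by gcongr) u).trans_lt hu)
  exact ⟨_, by positivity, fun u => hk (Set.mem_univ u)⟩

theorem integral_strictMono (ν : Measure (Sph n)) [IsFiniteMeasure ν] [NeZero ν]
    {f g : Sph n → ℝ} (hf : Continuous f) (hg : Continuous g) (hpos : ∀ u, 0 < f u)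
    (hfg : ∀ u, f u < g u) : ∫ u, H (f u) u ∂ν < ∫ u, H (g u) u ∂ν := by
  have hfi := hH.integrable ν hf hpos
  have hgi := hH.integrable ν hg fun u => (hpos u).trans (hfg u)
  have hlt : ∀ u, 0 < H (g u) u - H (f u) u := fun u =>
    sub_pos.2 (hH.strictMonoOn u (hpos u) ((hpos u).trans (hfg u)) (hfg u))
  rw [← sub_pos, ← integral_sub hgi hfi, integral_pos_iff_support_of_nonneg
    (fun u => (hlt u).le) (hgi.sub hfi)]
  have : (Function.support fun u => H (g u) u - H (f u) u) = Set.univ :=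
    Set.eq_univ_of_forall fun u => (hlt u).ne'
  rw [this]
  exact Measure.measure_univ_pos.2 (NeZero.ne ν)

theorem integral_mono (ν : Measure (Sph n)) [IsFiniteMeasure ν]
    {f g : Sph n → ℝ} (hf : Continuous f) (hg : Continuous g) (hpos : ∀ u, 0 < f u)
    (hfg : ∀ u, f u ≤ g u) : ∫ u, H (f u) u ∂ν ≤ ∫ u, H (g u) u ∂ν :=
  MeasureTheory.integral_mono (hH.integrable ν hf hpos)
    (hH.integrable ν hg fun u => (hpos u).trans_le (hfg u)) fun u => hH.mono (hpos u) (hfg u) u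

section lux

variable (ν : Measure (Sph n)) [IsFiniteMeasure ν] {f g : Sph n → ℝ}
  (hf : Continuous f) (hpos : ∀ u, 0 < f u)
include hf hpos

theorem luxInt_mono (hg : Continuous g) (hfg : ∀ u, f u ≤ g u) {η : ℝ} (hη : 0 < η) :
    luxInt ν H f η ≤ luxInt ν H g η :=
  hH.integral_mono ν (hf.div_const _) (hg.div_const _) (fun u => div_pos (hpos u) hη)
    fun u => div_le_div_of_nonneg_right (hfg u) hη.le

theorem luxInt_strictAntiOn [NeZero ν] : StrictAntiOn (luxInt ν H f) (Set.Ioi 0) :=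
  fun a (ha : 0 < a) b (hb : 0 < b) hab =>
    hH.integral_strictMono ν (hf.div_const _) (hf.div_const _) (fun u => div_pos (hpos u) hb)
      fun u => div_lt_div_of_pos_left (hpos u) ha hab

theorem luxInt_continuousOn : ContinuousOn (luxInt ν H f) (Set.Ioi 0) := by
  rw [continuousOn_iff_continuous_domRestrict]
  have : LocallyCompactSpace (Set.Ioi (0 : ℝ)) := isOpen_Ioi.locallyCompactSpace
  have := continuous_parametric_integral_of_continuous (μ := ν)
    (f := fun (x : Set.Ioi (0 : ℝ)) (u : Sph n) => H (f u / (x : ℝ)) u)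
    (hH.continuous_comp
      ((hf.comp continuous_snd).div (continuous_subtype_val.comp continuous_fst)
        fun p => (show (0 : ℝ) < p.1 from p.1.2).ne') continuous_snd
      fun p => div_pos (hpos _) p.1.2) isCompact_univ
  simp only [Measure.restrict_univ] at this
  exact this

theorem exists_luxInt_gt [NeZero ν] (c : ℝ) : ∃ η, 0 < η ∧ c < luxInt ν H f η := by
  have hν : 0 < ν.real Set.univ := by
    simpa [Measure.real, ENNReal.toReal_pos_iff] using (NeZero.ne ν)
  obtain ⟨T, hT, hTc⟩ := hH.exists_forall_gt (max c 0 / ν.real Set.univ + 1)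
  obtain ⟨m, hm, hmf⟩ := exists_pos_le_of_continuous hf hpos
  refine ⟨m / T, by positivity, ?_⟩
  calc c ≤ max c 0 := le_max_left _ _
    _ < ν.real Set.univ * (max c 0 / ν.real Set.univ + 1) := by
      rw [mul_add, mul_div_cancel₀ _ hν.ne']; linarith
    _ = ∫ _, (max c 0 / ν.real Set.univ + 1) ∂ν := by simp
    _ ≤ luxInt ν H f (m / T) := by
      refine MeasureTheory.integral_mono (integrable_const _)
        (hH.integrable ν (hf.div_const _) fun u => div_pos (hpos u) (by positivity)) fun u => ?_
      refine (hTc u).le.trans (hH.mono hT ?_ u)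
      rw [le_div_iff₀ (by positivity), mul_div_cancel₀ _ hT.ne']
      exact hmf u

theorem exists_luxInt_lt {c : ℝ} (hc : 0 < c) : ∃ η, 0 < η ∧ luxInt ν H f η < c := by
  obtain ⟨T, hT, hTc⟩ := hH.exists_forall_lt (c := c / (ν.real Set.univ + 1)) (by positivity)
  -- A positive lower bound for `1 / f` gives the upper bound `m⁻¹` for `f`.
  obtain ⟨m, hm, hmf⟩ := exists_pos_le_of_continuous (hf.inv₀ fun u => (hpos u).ne')
    fun u => inv_pos.2 (hpos u)
  replace hmf : ∀ u, f u ≤ m⁻¹ := fun u => (le_inv_comm₀ hm (hpos u)).1 (hmf u)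
  replace hm := inv_pos.2 hm
  generalize m⁻¹ = m at hm hmf
  refine ⟨m / T, by positivity, ?_⟩
  calc luxInt ν H f (m / T) ≤ ∫ _, c / (ν.real Set.univ + 1) ∂ν := by
        refine MeasureTheory.integral_mono
          (hH.integrable ν (hf.div_const _) fun u => div_pos (hpos u) (by positivity))
          (integrable_const _) fun u => ?_
        refine (hH.mono (div_pos (hpos u) (by positivity)) ?_ u).trans (hTc u).le
        rw [div_le_iff₀ (by positivity), mul_div_cancel₀ _ hT.ne']
        exact hmf u
    _ = c * (ν.real Set.univ / (ν.real Set.univ + 1)) := by simp; ring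
    _ < c * 1 := by
      gcongr
      rw [div_lt_one (by positivity)]; linarith
    _ = c := mul_one c

theorem exists_luxInt_eq [NeZero ν] {c : ℝ} (hc : 0 < c) : ∃ η, 0 < η ∧ luxInt ν H f η = c := by
  obtain ⟨a, ha, hac⟩ := hH.exists_luxInt_lt ν hf hpos hc
  obtain ⟨b, hb, hbc⟩ := hH.exists_luxInt_gt ν hf hpos c
  obtain ⟨x, hx, h⟩ := isPreconnected_Ioi.intermediate_value (Set.mem_Ioi.2 ha)
    (Set.mem_Ioi.2 hb) (hH.luxInt_continuousOn ν hf hpos) ⟨hac.le, hbc.le⟩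
  exact ⟨x, hx, h⟩

variable [NeZero ν]

/-- By strict monotonicity the admissible parameters form exactly `[η, ∞)`. -/
theorem lux_eq {η : ℝ} (hη : 0 < η) (h : luxInt ν H f η = 1) : lux ν H f = η := by
  have : {η : ℝ | 0 < η ∧ luxInt ν H f η ≤ 1} = Set.Ici η := by
    ext x
    simp only [Set.mem_ofPred_eq, Set.mem_Ici]
    constructor
    · rintro ⟨hx, hx1⟩
      rw [← h] at hx1
      exact ((hH.luxInt_strictAntiOn ν hf hpos).le_iff_ge hx hη).1 hx1
    · intro hx
      refine ⟨hη.trans_le hx, ?_⟩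
      rw [← h]
      exact ((hH.luxInt_strictAntiOn ν hf hpos).le_iff_ge (hη.trans_le hx) hη).2 hx
  rw [lux, this, csInf_Ici]

theorem lux_spec : 0 < lux ν H f ∧ luxInt ν H f (lux ν H f) = 1 := by
  obtain ⟨η, hη, h⟩ := hH.exists_luxInt_eq ν hf hpos one_pos
  rw [hH.lux_eq ν hf hpos hη h]
  exact ⟨hη, h⟩

theorem lux_le_iff {η : ℝ} (hη : 0 < η) : lux ν H f ≤ η ↔ luxInt ν H f η ≤ 1 := by
  obtain ⟨h0, h1⟩ := hH.lux_spec ν hf hpos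
  conv_rhs => rw [← h1]
  exact ((hH.luxInt_strictAntiOn ν hf hpos).le_iff_ge hη h0).symm

theorem le_lux_iff {η : ℝ} (hη : 0 < η) : η ≤ lux ν H f ↔ 1 ≤ luxInt ν H f η := by
  obtain ⟨h0, h1⟩ := hH.lux_spec ν hf hpos
  conv_rhs => rw [← h1]
  exact ((hH.luxInt_strictAntiOn ν hf hpos).le_iff_ge h0 hη).symm

theorem lux_mono (hg : Continuous g) (hfg : ∀ u, f u ≤ g u) : lux ν H f ≤ lux ν H g := by
  have hgpos : ∀ u, 0 < g u := fun u => (hpos u).trans_le (hfg u)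
  obtain ⟨h0, h1⟩ := hH.lux_spec ν hg hgpos
  rw [hH.lux_le_iff ν hf hpos h0, ← h1]
  exact hH.luxInt_mono ν hf hpos hg hfg h0

theorem lux_const_mul {c : ℝ} (hc : 0 < c) : lux ν H (fun u => c * f u) = c * lux ν H f := by
  obtain ⟨h0, h1⟩ := hH.lux_spec ν hf hpos
  refine hH.lux_eq ν (hf.const_mul c) (fun u => mul_pos hc (hpos u)) (mul_pos hc h0) ?_
  rw [← h1]
  refine integral_congr_ae (Eventually.of_forall fun u => ?_)
  simp only [mul_div_mul_left _ _ hc.ne']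

end lux

end ClassGI

/-- Absorbing the factor `1 / μ.mass` into the integrand turns the Orlicz norm into an instance of
`lux`. -/
theorem ClassI.classGI_const_mul {φ : ℝ → ℝ} (hφ : ClassI φ) {c : ℝ} (hc : 0 < c) :
    ClassGI (n := n) fun t _ => c * φ t where
  continuousOn := continuousOn_const.mul
    (hφ.continuousOn.comp continuousOn_fst fun p hp => hp.1)
  pos t ht _ := mul_pos hc (hφ.pos t ht)
  strictMonoOn _ := fun a ha b hb hab => mul_lt_mul_of_pos_left (hφ.strictMonoOn ha hb hab) hc
  tendsto_zero _ := by simpa using hφ.tendsto_zero.const_mul c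
  tendsto_atTop _ := hφ.tendsto_atTop.const_mul_atTop hc

/-! ### Support functions and radial functions of polars -/

section support

variable (K L : ConvexBody (Euc n))

theorem exists_inner_eq_supportFun (u : Sph n) :
    ∃ x ∈ K, inner ℝ x (u : Euc n) = supportFun (K : Set (Euc n)) u := by
  obtain ⟨x, hx, h⟩ := K.isCompact.exists_sSup_image_eq (f := fun x : Euc n => inner ℝ x (u : Euc n))
    K.nonempty (by fun_prop)
  exact ⟨x, hx, h.symm⟩

variable {K L}

theorem inner_le_supportFun {x : Euc n} (hx : x ∈ K) (u : Sph n) :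
    inner ℝ x (u : Euc n) ≤ supportFun (K : Set (Euc n)) u :=
  le_csSup (K.isCompact.bddAbove_image (by fun_prop)) ⟨x, hx, rfl⟩

theorem supportFun_le {u : Sph n} {c : ℝ} (h : ∀ x ∈ K, inner ℝ x (u : Euc n) ≤ c) :
    supportFun (K : Set (Euc n)) u ≤ c := by
  obtain ⟨x, hx, hxu⟩ := exists_inner_eq_supportFun K u
  exact hxu ▸ h x hx

/-- Hahn–Banach: a functional separating an outside point from `K`, normalized to a unit vector,
violates one of the inequalities. It is nonzero because `K` is nonempty. -/
theorem mem_of_forall_inner_le {y : Euc n}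
    (h : ∀ u : Sph n, inner ℝ y (u : Euc n) ≤ supportFun (K : Set (Euc n)) u) : y ∈ K := by
  by_contra hy
  obtain ⟨f, s, hfs, hsy⟩ := geometric_hahn_banach_closed_point K.convex K.isClosed hy
  set v := (InnerProductSpace.toDual ℝ (Euc n)).symm f with hv
  have hfv : ∀ x, f x = inner ℝ x v := fun x => by
    rw [real_inner_comm, hv, InnerProductSpace.toDual_symm_apply]
  obtain ⟨x0, hx0⟩ := K.nonempty
  have hv0 : v ≠ 0 := by
    intro h0
    have h1 := hfs x0 hx0
    rw [hfv, h0, inner_zero_right] at h1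
    rw [hfv, h0, inner_zero_right] at hsy
    linarith
  have hnv : 0 < ‖v‖ := norm_pos_iff.2 hv0
  let u : Sph n := ⟨‖v‖⁻¹ • v, by simp [norm_smul, hnv.ne']⟩
  have hu : ∀ x, inner ℝ x (u : Euc n) = ‖v‖⁻¹ * f x := fun x => by
    rw [hfv]; exact real_inner_smul_right _ _ _
  have h1 := h u
  have h2 : supportFun (K : Set (Euc n)) u ≤ ‖v‖⁻¹ * s := supportFun_le fun x hx => by
    rw [hu]; exact mul_le_mul_of_nonneg_left (hfs x hx).le (by positivity)
  rw [hu] at h1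
  have h3 := mul_lt_mul_of_pos_left hsy (inv_pos.2 hnv)
  linarith

theorem eq_of_supportFun_eq
    (h : ∀ u, supportFun (K : Set (Euc n)) u = supportFun (L : Set (Euc n)) u) : K = L :=
  SetLike.ext fun _ => ⟨
    fun hx => mem_of_forall_inner_le fun u => h u ▸ inner_le_supportFun hx u,
    fun hx => mem_of_forall_inner_le fun u => (h u).symm ▸ inner_le_supportFun hx u⟩

theorem supportFun_le_add {R : ℝ} (hR : ∀ x ∈ K, ‖x‖ ≤ R) (u v : Sph n) :
    supportFun (K : Set (Euc n)) u ≤ supportFun (K : Set (Euc n)) v + R * dist u v :=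
  supportFun_le fun x hx => by
    have h1 : inner ℝ x (u : Euc n) = inner ℝ x (v : Euc n) + inner ℝ x ((u : Euc n) - v) := by
      rw [inner_sub_right]; ring
    have h2 : inner ℝ x ((u : Euc n) - v) ≤ ‖x‖ * ‖(u : Euc n) - v‖ := real_inner_le_norm _ _
    have h3 : dist u v = ‖(u : Euc n) - v‖ := by rw [Subtype.dist_eq, dist_eq_norm]
    rw [h1, h3]
    exact add_le_add (inner_le_supportFun hx v)
      (h2.trans (mul_le_mul_of_nonneg_right (hR x hx) (norm_nonneg _)))

variable (K) in
theorem continuous_supportFun : Continuous (supportFun (K : Set (Euc n))) := by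
  obtain ⟨R, hR⟩ := K.isBounded.exists_norm_le
  have hR0 : 0 ≤ R := (norm_nonneg _).trans (hR _ K.nonempty.some_mem)
  refine (LipschitzWith.of_le_add_mul ⟨R, hR0⟩ fun u v => ?_).continuous
  exact supportFun_le_add hR u v

variable (K L) in
theorem supportFun_le_add_dist (u : Sph n) :
    supportFun (K : Set (Euc n)) u ≤ supportFun (L : Set (Euc n)) u + dist K L := by
  refine le_of_forall_pos_le_add fun ε hε => supportFun_le fun x hx => ?_
  obtain ⟨y, hy, hxy⟩ := Metric.exists_dist_lt_of_hausdorffDist_lt (s := (K : Set (Euc n)))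
    (t := (L : Set (Euc n))) (r := dist K L + ε) hx (by
      rw [ConvexBody.hausdorffDist_coe]; linarith) ConvexBody.hausdorffEDist_ne_top
  have h1 : inner ℝ x (u : Euc n) = inner ℝ y (u : Euc n) + inner ℝ (x - y) (u : Euc n) := by
    rw [inner_sub_left]; ring
  have h2 : inner ℝ (x - y) (u : Euc n) ≤ ‖x - y‖ * ‖(u : Euc n)‖ := real_inner_le_norm _ _
  rw [norm_eq_of_mem_sphere u, mul_one, ← dist_eq_norm] at h2
  linarith [inner_le_supportFun (K := L) hy u]

theorem supportFun_pos (hK : K ∈ bodiesAroundOrigin n) (u : Sph n) :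
    0 < supportFun (K : Set (Euc n)) u := by
  obtain ⟨r, hr, hrK⟩ := Metric.nhds_basis_closedBall.mem_iff.1 (mem_interior_iff_mem_nhds.1 hK)
  have h : r • (u : Euc n) ∈ K := hrK (by
    simp [norm_smul, abs_of_pos hr])
  refine lt_of_lt_of_le hr (le_trans (le_of_eq ?_) (inner_le_supportFun h u))
  rw [real_inner_smul_left, real_inner_self_eq_norm_sq, norm_eq_of_mem_sphere u]
  ring

theorem mem_bodiesAroundOrigin (h : ∀ u, 0 < supportFun (K : Set (Euc n)) u) :
    K ∈ bodiesAroundOrigin n := by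
  obtain ⟨m, hm, hmh⟩ := exists_pos_le_of_continuous (continuous_supportFun K) h
  refine mem_interior_iff_mem_nhds.2 (mem_of_superset (Metric.closedBall_mem_nhds _ hm) ?_)
  intro y hy
  refine mem_of_forall_inner_le fun u => (real_inner_le_norm _ _).trans ?_
  rw [norm_eq_of_mem_sphere u, mul_one]
  exact (mem_closedBall_zero_iff.1 hy).trans (hmh u)

open Pointwise in
variable (K L) in
theorem supportFun_add (u : Sph n) :
    supportFun ((K + L : ConvexBody (Euc n)) : Set (Euc n)) u =
      supportFun (K : Set (Euc n)) u + supportFun (L : Set (Euc n)) u := by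
  apply le_antisymm
  · refine supportFun_le fun z hz => ?_
    obtain ⟨x, hx, y, hy, rfl⟩ := Set.mem_add.1 (show z ∈ (K : Set (Euc n)) + L from hz)
    rw [inner_add_left]
    exact add_le_add (inner_le_supportFun hx u) (inner_le_supportFun hy u)
  · obtain ⟨x, hx, hxu⟩ := exists_inner_eq_supportFun K u
    obtain ⟨y, hy, hyu⟩ := exists_inner_eq_supportFun L u
    rw [← hxu, ← hyu, ← inner_add_left]
    exact inner_le_supportFun (show x + y ∈ (K : Set (Euc n)) + L from Set.add_mem_add hx hy) u

open Pointwise in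
variable (K) in
theorem supportFun_smul {c : ℝ} (hc : 0 ≤ c) (u : Sph n) :
    supportFun ((c • K : ConvexBody (Euc n)) : Set (Euc n)) u =
      c * supportFun (K : Set (Euc n)) u := by
  apply le_antisymm
  · refine supportFun_le fun z hz => ?_
    obtain ⟨x, hx, rfl⟩ := Set.mem_smul_set.1 (show z ∈ c • (K : Set (Euc n)) from hz)
    rw [real_inner_smul_left]
    exact mul_le_mul_of_nonneg_left (inner_le_supportFun hx u) hc
  · obtain ⟨x, hx, hxu⟩ := exists_inner_eq_supportFun K u
    rw [← hxu, ← real_inner_smul_left]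
    exact inner_le_supportFun (show c • x ∈ c • (K : Set (Euc n)) from Set.smul_mem_smul_set hx) u

theorem radialFun_polarSet (hK : K ∈ bodiesAroundOrigin n) (u : Sph n) :
    radialFun (polarSet (K : Set (Euc n))) u = 1 / supportFun (K : Set (Euc n)) u := by
  have hpos := supportFun_pos hK u
  have : {t : ℝ | 0 ≤ t ∧ t • (u : Euc n) ∈ polarSet (K : Set (Euc n))} =
      Set.Icc 0 (1 / supportFun (K : Set (Euc n)) u) := by
    ext t
    refine and_congr_right fun ht => ?_
    rw [le_div_iff₀ hpos]
    constructor
    · intro h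
      obtain ⟨x, hx, hxu⟩ := exists_inner_eq_supportFun K u
      rw [← hxu, real_inner_comm, ← real_inner_smul_left]
      exact h x hx
    · intro h x hx
      rw [real_inner_smul_left, real_inner_comm]
      exact (mul_le_mul_of_nonneg_left (inner_le_supportFun hx u) ht).trans h
  rw [radialFun, this, csSup_Icc (by positivity)]

end support

theorem radialFun_closedBall (u : Sph n) : radialFun (Metric.closedBall 0 1) u = 1 := by
  have : {t : ℝ | 0 ≤ t ∧ t • (u : Euc n) ∈ Metric.closedBall (0 : Euc n) 1} = Set.Icc 0 1 := by
    ext t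
    refine and_congr_right fun ht => ?_
    rw [mem_closedBall_zero_iff, norm_smul, norm_eq_of_mem_sphere u, mul_one, Real.norm_eq_abs,
      abs_of_nonneg ht]
  rw [radialFun, this, csSup_Icc zero_le_one]

/-! ### Blaschke selection -/

/-- **Blaschke's selection theorem.** -/
theorem exists_subseq_tendsto_convexBody {R : ℝ} (K : ℕ → ConvexBody (Euc n))
    (hK : ∀ i, ∀ x ∈ K i, ‖x‖ ≤ R) :
    ∃ (L : ConvexBody (Euc n)) (k : ℕ → ℕ), StrictMono k ∧ Tendsto (K ∘ k) atTop (𝓝 L) := by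
  let C : ℕ → TopologicalSpace.NonemptyCompacts (Euc n) := fun i =>
    ⟨⟨K i, (K i).isCompact⟩, (K i).nonempty⟩
  obtain ⟨A, hA, k, hk, hlim⟩ :=
    (TopologicalSpace.NonemptyCompacts.isCompact_subsets_of_isCompact
      (isCompact_closedBall (0 : Euc n) R)).tendsto_subseq (x := C)
      fun i x hx => mem_closedBall_zero_iff.2 (hK i x hx)
  have hdist : Tendsto (fun i => Metric.hausdorffDist (K (k i) : Set (Euc n)) A) atTop (𝓝 0) :=
    tendsto_iff_dist_tendsto_zero.1 hlim
  have hfin : ∀ i, Metric.hausdorffEDist (K i : Set (Euc n)) A ≠ ⊤ := fun i =>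
    Metric.hausdorffEDist_ne_top_of_nonempty_of_bounded (K i).nonempty A.nonempty
      (K i).isBounded A.isCompact.isBounded
  -- Convexity passes to the limit: approximate two points of `A` within `K (k i)`, combine there,
  -- and return to `A` with total error at most `ε`.
  have hconv : Convex ℝ (A : Set (Euc n)) := by
    intro x hx y hy a b ha hb hab
    rw [← A.isCompact.isClosed.closure_eq, Metric.mem_closure_iff_infDist_zero A.nonempty]
    refine le_antisymm (le_of_forall_pos_le_add fun ε hε => ?_) Metric.infDist_nonneg
    obtain ⟨i, hi⟩ := (hdist.eventually_lt_const (half_pos hε)).exists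
    obtain ⟨x', hx', hxx⟩ := Metric.exists_dist_lt_of_hausdorffDist_lt' hx hi (hfin _)
    obtain ⟨y', hy', hyy⟩ := Metric.exists_dist_lt_of_hausdorffDist_lt' hy hi (hfin _)
    have h1 := Metric.infDist_le_hausdorffDist_of_mem ((K (k i)).convex hx' hy' ha hb hab)
      (hfin (k i))
    have h2 : Metric.infDist (a • x + b • y) (A : Set (Euc n)) ≤
        Metric.infDist (a • x' + b • y') A + dist (a • x + b • y) (a • x' + b • y') :=
      Metric.infDist_le_infDist_add_dist
    have h3 : dist (a • x + b • y) (a • x' + b • y') ≤ ε / 2 := by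
      refine (dist_add_add_le _ _ _ _).trans ?_
      rw [dist_smul₀, dist_smul₀, Real.norm_of_nonneg ha, Real.norm_of_nonneg hb, dist_comm x,
        dist_comm y]
      calc a * dist x' x + b * dist y' y ≤ a * (ε / 2) + b * (ε / 2) := by gcongr
        _ = ε / 2 := by rw [← add_mul, hab, one_mul]
    linarith
  refine ⟨⟨A, hconv, A.isCompact, A.nonempty⟩, k, hk, ?_⟩
  rw [tendsto_iff_dist_tendsto_zero]
  exact hdist

/-! ### Spherical caps and non-degeneration of limits -/

-- For `y` in the small ball, `‖y‖` differs from `t` by less than `r / 16`, so `t * ‖y / ‖y‖ - v‖ ≤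
-- r / 8`; since `t ≥ 1 / 4`, the direction of `y` lies within `r / 2` of `v`. Thus the cone over a
-- cap contains balls centred along the ray through `v`.
open Pointwise in
theorem ball_smul_subset_Ioo_smul_ball (v : Sph n) {r t : ℝ} (hr : 0 < r) (hr1 : r ≤ 1)
    (ht : 1 / 4 ≤ t) (ht1 : t ≤ 3 / 4) :
    Metric.ball (t • (v : Euc n)) (r / 16) ⊆
      Set.Ioo (0 : ℝ) 1 • ((↑) '' (Metric.ball v r) : Set (Euc n)) := by
  intro y hy
  rw [mem_ball_iff_norm] at hy
  have hv : ‖(v : Euc n)‖ = 1 := norm_eq_of_mem_sphere v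
  have ht0 : 0 < t := by linarith
  have htv : ‖t • (v : Euc n)‖ = t := by rw [norm_smul, hv, mul_one, Real.norm_of_nonneg ht0.le]
  have habs := abs_norm_sub_norm_le y (t • (v : Euc n))
  rw [htv] at habs
  obtain ⟨h1, h2⟩ := abs_le.1 (habs.trans hy.le)
  have hy0 : 0 < ‖y‖ := by linarith
  refine Set.mem_smul.2 ⟨‖y‖, ⟨hy0, by linarith⟩, ‖y‖⁻¹ • y,
    ⟨⟨‖y‖⁻¹ • y, by simp [norm_smul, hy0.ne']⟩, ?_, rfl⟩, ?_⟩
  · rw [Metric.mem_ball, Subtype.dist_eq, dist_eq_norm]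
    have h3 : t • (‖y‖⁻¹ • y - (v : Euc n)) =
        (t - ‖y‖) • (‖y‖⁻¹ • y) + (y - t • (v : Euc n)) := by
      rw [smul_sub, sub_smul, smul_smul ‖y‖, mul_inv_cancel₀ hy0.ne', one_smul]
      abel
    have h4 : ‖t • (‖y‖⁻¹ • y - (v : Euc n))‖ ≤ r / 8 := by
      rw [h3]
      refine (norm_add_le _ _).trans ?_
      rw [norm_smul, norm_smul, norm_inv, norm_norm, inv_mul_cancel₀ hy0.ne', mul_one,
        Real.norm_eq_abs, abs_sub_comm]
      linarith [habs]
    rw [norm_smul, Real.norm_of_nonneg ht0.le] at h4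
    nlinarith [norm_nonneg (‖y‖⁻¹ • y - (v : Euc n))]
  · rw [smul_smul, mul_inv_cancel₀ hy0.ne', one_smul]

open Pointwise in
/-- Caps of radius `r` have spherical measure at least of the order of `r ^ (n - 1)`. -/
theorem exists_mul_pow_le_sphericalMeasure_ball (hn : 1 ≤ n) :
    ∃ c : ℝ, 0 < c ∧ ∀ (v : Sph n) (r : ℝ), 0 < r → r ≤ 1 →
      c * r ^ n / r ≤ (sphericalMeasure n).real (Metric.ball v r) := by
  have hB : 0 < (volume : Measure (Euc n)).real (Metric.ball 0 1) :=
    ENNReal.toReal_pos (Metric.measure_ball_pos _ _ one_pos).ne' measure_ball_lt_top.ne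
  have hn0 : (0 : ℝ) < n := by exact_mod_cast hn
  refine ⟨n * (4 * (1 / 16) ^ n * (volume : Measure (Euc n)).real (Metric.ball 0 1)),
    by positivity, fun v r hr hr1 => ?_⟩
  -- At least `4 / r` disjoint balls of radius `r / 16`, with centres spaced by `r / 8` from `v / 4`
  -- to at most `3 v / 4`, fit in the cone. Their total volume is of order `r ^ n / r`, which is `r
  -- ^ (n - 1)` without truncated subtraction.
  set N := ⌊4 / r⌋₊ + 1 with hN
  have hN4 : 4 / r ≤ (N : ℝ) := by rw [hN]; push_cast; exact (Nat.lt_floor_add_one _).le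
  let t : ℕ → ℝ := fun k => 1 / 4 + k * (r / 8)
  have hdisj : Set.PairwiseDisjoint (Finset.range N : Set ℕ)
      fun k => Metric.ball (t k • (v : Euc n)) (r / 16) := by
    intro k _ l _ hkl
    refine Metric.ball_disjoint_ball ?_
    rw [dist_eq_norm, ← sub_smul, norm_smul, norm_eq_of_mem_sphere v, mul_one, Real.norm_eq_abs]
    have h1 : t k - t l = ((k : ℤ) - (l : ℤ) : ℤ) * (r / 8) := by simp only [t]; push_cast; ring
    have h2 : (1 : ℝ) ≤ |(((k : ℤ) - (l : ℤ) : ℤ) : ℝ)| := by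
      rw [← Int.cast_abs, ← Int.cast_one, Int.cast_le]
      exact Int.one_le_abs (sub_ne_zero.2 (Int.natCast_inj.not.2 hkl))
    rw [h1, abs_mul, abs_of_pos (by positivity : 0 < r / 8)]
    nlinarith
  have hsub : (⋃ k ∈ Finset.range N, Metric.ball (t k • (v : Euc n)) (r / 16)) ⊆
      Set.Ioo (0 : ℝ) 1 • ((↑) '' (Metric.ball v r) : Set (Euc n)) := by
    refine Set.iUnion₂_subset fun k hk => ?_
    have hk' : (k : ℝ) ≤ 4 / r := by
      rw [Finset.mem_range, hN, Nat.lt_succ_iff] at hk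
      exact (Nat.le_floor_iff (by positivity)).1 hk
    have hkr : k * (r / 8) ≤ 1 / 2 := by
      rw [le_div_iff₀ hr] at hk'; linarith
    exact ball_smul_subset_Ioo_smul_ball v hr hr1
      (by simp only [t]; linarith [show (0 : ℝ) ≤ k * (r / 8) by positivity])
      (by simp only [t]; linarith)
  have hmeas : ENNReal.ofReal (n * (N * ((r / 16) ^ n *
      (volume : Measure (Euc n)).real (Metric.ball 0 1)))) ≤
      sphericalMeasure n (Metric.ball v r) := by
    rw [Measure.toSphere_apply' _ Metric.isOpen_ball.measurableSet, finrank_euclideanSpace,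
      Fintype.card_fin]
    refine le_trans (le_of_eq ?_) (mul_le_mul_right (measure_mono hsub) _)
    rw [measure_biUnion_finset hdisj fun k _ => Metric.isOpen_ball.measurableSet,
      Finset.sum_congr rfl fun k _ =>
        Measure.addHaar_ball_of_pos volume (t k • (v : Euc n)) (by positivity : 0 < r / 16),
      Finset.sum_const, Finset.card_range, finrank_euclideanSpace, Fintype.card_fin, nsmul_eq_mul,
      ENNReal.ofReal_mul hn0.le, ENNReal.ofReal_natCast, ENNReal.ofReal_mul (by positivity),
      ENNReal.ofReal_natCast, ENNReal.ofReal_mul (by positivity), ofReal_measureReal]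
  refine le_trans ?_ ((ENNReal.ofReal_le_iff_le_toReal (measure_ne_top _ _)).1 hmeas)
  rw [div_pow, div_pow, one_pow]
  calc _ = n * (4 / r * (r ^ n / 16 ^ n *
        (volume : Measure (Euc n)).real (Metric.ball 0 1))) := by
        field_simp
    _ ≤ _ := by gcongr

/-- By Fatou the lower limit `g` of `G(1 / h_i, ·)` would be integrable, so its integral over caps
shrinking to `v` would tend to its integral over `{v}`, which is 0. But on the cap of radius `r` it
is at least of order `r ^ (-q)`, while the cap has measure at least of order `r ^ (n - 1)`; as `q ≥
n - 1`, the cap integrals stay above a constant `κ`. This covers the borderline `q = n - 1`. -/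
theorem ClassGI.not_bounded_of_tendsto_zero (hn : 1 ≤ n) {G : ℝ → Sph n → ℝ} (hG : ClassGI G)
    {q c T R C : ℝ} (hq : (n : ℝ) - 1 ≤ q) (hc : 0 < c) (hR : 0 < R)
    (hGq : ∀ t, T ≤ t → ∀ u, c * t ^ q ≤ G t u) {h : ℕ → Sph n → ℝ}
    (hcont : ∀ i, Continuous (h i)) (hpos : ∀ i u, 0 < h i u) {v : Sph n}
    (hlip : ∀ i u, h i u ≤ h i v + R * dist u v)
    (hlim : Tendsto (fun i => h i v) atTop (𝓝 0)) :
    ¬ ∀ i, ∫ u, G (1 / h i u) u ∂(sphericalMeasure n) ≤ C := by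
  intro hC
  have hq0 : 0 ≤ q := by
    have : (1 : ℝ) ≤ n := by exact_mod_cast hn
    linarith
  set F : ℕ → Sph n → ENNReal := fun i u => ENNReal.ofReal (G (1 / h i u) u) with hF
  have hcontG : ∀ i, Continuous fun u => G (1 / h i u) u := fun i =>
    hG.continuous_comp (continuous_const.div (hcont i) fun u => (hpos i u).ne') continuous_id
      fun u => one_div_pos.2 (hpos i u)
  have hFm : ∀ i, Measurable (F i) := fun i => (hcontG i).measurable.ennreal_ofReal
  set g : Sph n → ENNReal := fun u => liminf (fun i => F i u) atTop with hg
  have hgm : Measurable g := Measurable.liminf hFm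
  have hgint : ∫⁻ u, g u ∂(sphericalMeasure n) ≤ ENNReal.ofReal C := by
    refine (lintegral_liminf_le hFm).trans ?_
    refine (liminf_le_liminf (Eventually.of_forall fun i => ?_)).trans
      (liminf_const (f := (atTop : Filter ℕ)) (ENNReal.ofReal C)).le
    rw [hF, ← ofReal_integral_eq_lintegral_ofReal (f := fun u => G (1 / h i u) u)
      (hG.integrable _ (f := fun u => 1 / h i u)
        (continuous_const.div (hcont i) fun u => (hpos i u).ne') fun u => one_div_pos.2 (hpos i u))
      (Eventually.of_forall fun u => (hG.pos _ (one_div_pos.2 (hpos i u)) u).le)]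
    exact ENNReal.ofReal_le_ofReal (hC i)
  have hgv : g v = ⊤ := by
    refine Tendsto.liminf_eq (ENNReal.tendsto_ofReal_nhds_top.2 ?_)
    refine (hG.tendsto_atTop v).comp ?_
    simp only [one_div]
    exact tendsto_inv_nhdsGT_zero.comp (tendsto_nhdsWithin_iff.2
      ⟨hlim, Eventually.of_forall fun i => hpos i v⟩)
  -- Once `h i v < R * r`, the Lipschitz bound gives `h i u ≤ 2 * R * r` on the cap.
  have hgu : ∀ r, 0 < r → T ≤ 1 / (2 * R * r) → ∀ u ∈ Metric.ball v r,
      ENNReal.ofReal (c * (1 / (2 * R * r)) ^ q) ≤ g u := by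
    intro r hr hTr u hu
    refine le_liminf_of_le (by isBoundedDefault) ?_
    filter_upwards [hlim.eventually_lt_const (mul_pos hR hr)] with i hi
    refine ENNReal.ofReal_le_ofReal ?_
    have h1 : h i u ≤ 2 * R * r := by
      have := mul_lt_mul_of_pos_left (Metric.mem_ball.1 hu) hR
      linarith [hlip i u]
    have h2 : 1 / (2 * R * r) ≤ 1 / h i u := one_div_le_one_div_of_le (hpos i u) h1
    refine le_trans ?_ (hGq _ (hTr.trans h2) u)
    gcongr
  obtain ⟨c', hc', hcap⟩ := exists_mul_pow_le_sphericalMeasure_ball hn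
  set κ : ℝ := c * (1 / (2 * R)) ^ q * c' with hκ
  have hκ0 : 0 < κ := by positivity
  have hlow : ∀ r, 0 < r → r ≤ 1 → T ≤ 1 / (2 * R * r) →
      ENNReal.ofReal κ ≤ (sphericalMeasure n).withDensity g (Metric.ball v r) := by
    intro r hr hr1 hTr
    rw [withDensity_apply _ Metric.isOpen_ball.measurableSet]
    calc ENNReal.ofReal κ ≤ ENNReal.ofReal (c * (1 / (2 * R * r)) ^ q * (c' * r ^ n / r)) := by
          refine ENNReal.ofReal_le_ofReal ?_
          have h1 : (1 / (2 * R * r)) ^ q = (1 / (2 * R)) ^ q * (1 / r ^ q) := by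
            rw [← one_div_mul_one_div, Real.mul_rpow (by positivity) (by positivity),
              Real.div_rpow zero_le_one hr.le, Real.one_rpow]
          have h2 : r ^ q * r ≤ r ^ n := by
            calc r ^ q * r = r ^ (q + 1) := by rw [Real.rpow_add hr, Real.rpow_one]
              _ ≤ r ^ (n : ℝ) := Real.rpow_le_rpow_of_exponent_ge hr hr1 (by linarith)
              _ = r ^ n := Real.rpow_natCast r n
          have h3 : 1 ≤ r ^ n / (r ^ q * r) := (one_le_div (by positivity)).2 h2
          calc κ ≤ κ * (r ^ n / (r ^ q * r)) := le_mul_of_one_le_right hκ0.le h3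
            _ = _ := by rw [h1, hκ]; field_simp
      _ = ENNReal.ofReal (c * (1 / (2 * R * r)) ^ q) * ENNReal.ofReal (c' * r ^ n / r) :=
          ENNReal.ofReal_mul (by positivity)
      _ ≤ ENNReal.ofReal (c * (1 / (2 * R * r)) ^ q) *
            sphericalMeasure n (Metric.ball v r) := by
          gcongr
          exact ENNReal.ofReal_le_of_le_toReal (hcap v r hr hr1)
      _ ≤ ∫⁻ u in Metric.ball v r, g u ∂(sphericalMeasure n) := by
          rw [← setLIntegral_const]
          exact setLIntegral_mono hgm (hgu r hr hTr)
  have hfin : ∀ s, (sphericalMeasure n).withDensity g s < ⊤ := fun s => by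
    refine (measure_mono (Set.subset_univ s)).trans_lt ?_
    rw [withDensity_apply _ MeasurableSet.univ, Measure.restrict_univ]
    exact hgint.trans_lt ENNReal.ofReal_lt_top
  -- Finiteness of the integral and `g v = ⊤` force `v` to be null; this also disposes of `n = 1`,
  -- where points are atoms.
  have hv0 : (sphericalMeasure n).withDensity g {v} = 0 := by
    have h1 := hfin {v}
    rw [withDensity_apply _ (measurableSet_singleton v), lintegral_singleton, hgv] at h1 ⊢
    by_contra h2
    rw [ENNReal.top_mul (fun h3 => h2 (by rw [h3, mul_zero]))] at h1
    exact lt_irrefl _ h1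
  have hinter : (⋂ k : ℕ, Metric.ball v (1 / ((k : ℝ) + 1))) = {v} := by
    refine Set.Subset.antisymm (fun u hu => ?_) fun u hu => ?_
    · refine dist_le_zero.1 (ge_of_tendsto' tendsto_one_div_add_atTop_nhds_zero_nat fun k => ?_)
      exact (Metric.mem_ball.1 (Set.mem_iInter.1 hu k)).le
    · rw [Set.mem_singleton_iff.1 hu]
      exact Set.mem_iInter.2 fun k => Metric.mem_ball_self (by positivity)
  have hlimv := tendsto_measure_iInter_atTop (μ := (sphericalMeasure n).withDensity g)
    (s := fun k : ℕ => Metric.ball v (1 / ((k : ℝ) + 1)))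
    (fun k => Metric.isOpen_ball.measurableSet.nullMeasurableSet)
    (fun k l hkl => Metric.ball_subset_ball (by gcongr)) ⟨0, (hfin _).ne⟩
  rw [hinter, hv0] at hlimv
  have hev : ∀ᶠ k : ℕ in atTop, T ≤ 1 / (2 * R * (1 / ((k : ℝ) + 1))) := by
    filter_upwards [eventually_ge_atTop ⌈2 * R * T⌉₊] with k hk
    rw [le_div_iff₀ (by positivity), mul_one_div, mul_div_assoc', div_le_one (by positivity)]
    linarith [Nat.ceil_le.1 hk]
  have h0 : ENNReal.ofReal κ ≤ 0 := ge_of_tendsto hlimv (by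
    filter_upwards [hev] with k hk
    refine hlow _ (by positivity) ?_ hk
    rw [div_le_one (by positivity)]
    linarith [show (0 : ℝ) ≤ k by positivity])
  exact (ENNReal.ofReal_pos.2 hκ0).not_ge h0

/-! ### Joint continuity of the Orlicz norm -/

theorem orliczNorm_eq_lux (μ : FiniteMeasure (Sph n)) (φ : ℝ → ℝ) (Q : ConvexBody (Euc n)) :
    orliczNorm μ φ Q = lux μ (fun t _ => 1 / (μ.mass : ℝ) * φ t) (supportFun (Q : Set (Euc n))) := by
  simp only [orliczNorm, lux, luxInt, integral_const_mul]

theorem mass_pos (μ : FiniteMeasure (Sph n)) [NeZero (μ : Measure (Sph n))] :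
    0 < (μ.mass : ℝ) :=
  NNReal.coe_pos.2 (pos_iff_ne_zero.2 ((FiniteMeasure.mass_nonzero_iff μ).2 fun h =>
    NeZero.ne (μ : Measure (Sph n)) (by rw [h]; rfl)))

theorem ClassI.classGI (μ : FiniteMeasure (Sph n)) [NeZero (μ : Measure (Sph n))] {φ : ℝ → ℝ}
    (hφ : ClassI φ) : ClassGI (n := n) fun t _ => 1 / (μ.mass : ℝ) * φ t :=
  hφ.classGI_const_mul (one_div_pos.2 (mass_pos μ))

theorem tendsto_integral_of_continuous {μs : ℕ → FiniteMeasure (Sph n)}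
    {μ : FiniteMeasure (Sph n)} (hweak : Tendsto μs atTop (𝓝 μ)) {f : Sph n → ℝ}
    (hf : Continuous f) :
    Tendsto (fun i => ∫ u, f u ∂(μs i : Measure (Sph n))) atTop
      (𝓝 (∫ u, f u ∂(μ : Measure (Sph n)))) :=
  FiniteMeasure.tendsto_iff_forall_integral_tendsto.1 hweak
    (BoundedContinuousFunction.mkOfCompact ⟨f, hf⟩)

theorem tendsto_mass_coe {μs : ℕ → FiniteMeasure (Sph n)}
    {μ : FiniteMeasure (Sph n)} (hweak : Tendsto μs atTop (𝓝 μ)) :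
    Tendsto (fun i => ((μs i).mass : ℝ)) atTop (𝓝 (μ.mass : ℝ)) :=
  NNReal.tendsto_coe.2 hweak.mass

section weak

variable {μs : ℕ → FiniteMeasure (Sph n)} {μ : FiniteMeasure (Sph n)}
  [∀ i, NeZero (μs i : Measure (Sph n))] [NeZero (μ : Measure (Sph n))]
  (hweak : Tendsto μs atTop (𝓝 μ)) {φ : ℝ → ℝ} (hφ : ClassI φ)
include hweak hφ

/-- At each fixed `η` the modulars converge by weak convergence; comparing them with 1 at `η` on
either side of the limiting value traps the functionals. -/
theorem tendsto_lux {f : Sph n → ℝ} (hf : Continuous f) (hpos : ∀ u, 0 < f u) :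
    Tendsto (fun i => lux (μs i) (fun t _ => 1 / ((μs i).mass : ℝ) * φ t) f) atTop
      (𝓝 (lux μ (fun t _ => 1 / (μ.mass : ℝ) * φ t) f)) := by
  have hI : ∀ η, 0 < η → Tendsto
      (fun i => luxInt (μs i) (fun t _ => 1 / ((μs i).mass : ℝ) * φ t) f η) atTop
      (𝓝 (luxInt μ (fun t _ => 1 / (μ.mass : ℝ) * φ t) f η)) := by
    intro η hη
    simp only [luxInt, integral_const_mul]
    refine ((tendsto_const_nhds.div (tendsto_mass_coe hweak) (mass_pos μ).ne')).mul
      (tendsto_integral_of_continuous hweak ?_)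
    exact hφ.continuousOn.comp_continuous (hf.div_const _) fun u => div_pos (hpos u) hη
  have hμ := hφ.classGI μ
  obtain ⟨h0, -⟩ := hμ.lux_spec (μ : Measure (Sph n)) hf hpos
  refine tendsto_order.2 ⟨fun a ha => ?_, fun b hb => ?_⟩
  · obtain ⟨η, hη1, hη2⟩ := exists_between (max_lt ha h0)
    have hη : 0 < η := (le_max_right _ _).trans_lt hη1
    have h1 := lt_of_not_ge (((hμ.lux_le_iff _ hf hpos hη).not.1 hη2.not_ge))
    filter_upwards [(hI η hη).eventually_const_lt h1] with i hi
    exact (le_max_left _ _).trans_lt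
      (hη1.trans_le (((hφ.classGI (μs i)).le_lux_iff _ hf hpos hη).2 hi.le))
  · obtain ⟨η, hη1, hη2⟩ := exists_between hb
    have hη : 0 < η := h0.trans hη1
    have h1 := lt_of_not_ge (((hμ.le_lux_iff _ hf hpos hη).not.1 hη1.not_ge))
    filter_upwards [(hI η hη).eventually_lt_const h1] with i hi
    exact (((hφ.classGI (μs i)).lux_le_iff _ hf hpos hη).2 hi.le).trans_lt hη2

theorem tendsto_orliczNorm_const {K : ConvexBody (Euc n)} (hK : K ∈ bodiesAroundOrigin n) :
    Tendsto (fun i => orliczNorm (μs i) φ K) atTop (𝓝 (orliczNorm μ φ K)) := by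
  simp only [orliczNorm_eq_lux]
  exact tendsto_lux hweak hφ (continuous_supportFun K) (supportFun_pos hK)

end weak

theorem orliczNorm_pos (μ : FiniteMeasure (Sph n)) [NeZero (μ : Measure (Sph n))] {φ : ℝ → ℝ}
    (hφ : ClassI φ) {K : ConvexBody (Euc n)} (hK : K ∈ bodiesAroundOrigin n) :
    0 < orliczNorm μ φ K := by
  rw [orliczNorm_eq_lux]
  exact ((hφ.classGI μ).lux_spec _ (continuous_supportFun K) (supportFun_pos hK)).1

theorem orliczNorm_le_mul (μ : FiniteMeasure (Sph n)) [NeZero (μ : Measure (Sph n))] {φ : ℝ → ℝ}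
    (hφ : ClassI φ) {K L : ConvexBody (Euc n)} (hK : K ∈ bodiesAroundOrigin n)
    (hL : L ∈ bodiesAroundOrigin n) {c : ℝ} (hc : 0 < c)
    (h : ∀ u, supportFun (K : Set (Euc n)) u ≤ c * supportFun (L : Set (Euc n)) u) :
    orliczNorm μ φ K ≤ c * orliczNorm μ φ L := by
  simp only [orliczNorm_eq_lux]
  rw [← (hφ.classGI μ).lux_const_mul _ (continuous_supportFun L) (supportFun_pos hL) hc]
  exact (hφ.classGI μ).lux_mono _ (continuous_supportFun K) (supportFun_pos hK)
    ((continuous_supportFun L).const_mul c) h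

theorem tendsto_supportFun {K : ℕ → ConvexBody (Euc n)} {L : ConvexBody (Euc n)}
    (h : Tendsto K atTop (𝓝 L)) (u : Sph n) :
    Tendsto (fun i => supportFun (K i : Set (Euc n)) u) atTop
      (𝓝 (supportFun (L : Set (Euc n)) u)) := by
  rw [tendsto_iff_dist_tendsto_zero] at h ⊢
  refine squeeze_zero (fun _ => dist_nonneg) (fun i => ?_) h
  rw [Real.dist_eq, abs_le]
  constructor
  · linarith [supportFun_le_add_dist L (K i) u, dist_comm L (K i)]
  · linarith [supportFun_le_add_dist (K i) L u]

theorem eventually_supportFun_between {K : ℕ → ConvexBody (Euc n)} {L : ConvexBody (Euc n)}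
    (h : Tendsto K atTop (𝓝 L)) (hL : L ∈ bodiesAroundOrigin n) {ε : ℝ} (hε : 0 < ε) :
    ∀ᶠ i in atTop, ∀ u, (1 - ε) * supportFun (L : Set (Euc n)) u ≤ supportFun (K i : Set (Euc n)) u ∧
      supportFun (K i : Set (Euc n)) u ≤ (1 + ε) * supportFun (L : Set (Euc n)) u := by
  obtain ⟨m, hm, hmL⟩ := exists_pos_le_of_continuous (continuous_supportFun L) (supportFun_pos hL)
  filter_upwards [(tendsto_iff_dist_tendsto_zero.1 h).eventually_lt_const (mul_pos hε hm)]
    with i hi u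
  have h1 := mul_le_mul_of_nonneg_left (hmL u) hε.le
  constructor
  · linarith [supportFun_le_add_dist L (K i) u, dist_comm L (K i)]
  · linarith [supportFun_le_add_dist (K i) L u]

/-- Since `h_L` is bounded away from 0, Hausdorff convergence gives `(1 - δ) h_L ≤ h_{K i} ≤ (1 + δ)
h_L`. Monotonicity and homogeneity transfer this to norms uniformly in the measure, reducing the
claim to the fixed body `L`. -/
theorem tendsto_orliczNorm {μs : ℕ → FiniteMeasure (Sph n)} {μ : FiniteMeasure (Sph n)}
    [∀ i, NeZero (μs i : Measure (Sph n))] [NeZero (μ : Measure (Sph n))]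
    (hweak : Tendsto μs atTop (𝓝 μ)) {φ : ℝ → ℝ} (hφ : ClassI φ)
    {K : ℕ → ConvexBody (Euc n)} {L : ConvexBody (Euc n)} (hK : ∀ i, K i ∈ bodiesAroundOrigin n)
    (hL : L ∈ bodiesAroundOrigin n) (h : Tendsto K atTop (𝓝 L)) :
    Tendsto (fun i => orliczNorm (μs i) φ (K i)) atTop (𝓝 (orliczNorm μ φ L)) := by
  have hy := tendsto_orliczNorm_const hweak hφ hL
  have hratio : Tendsto (fun i => orliczNorm (μs i) φ (K i) / orliczNorm (μs i) φ L) atTop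
      (𝓝 1) := by
    refine Metric.tendsto_atTop'.2 fun ε hε => ?_
    obtain ⟨δ, hδ0, hδ⟩ := exists_between (lt_min hε one_pos)
    obtain ⟨hδε, hδ1⟩ := lt_min_iff.1 hδ
    obtain ⟨N, hN⟩ := eventually_atTop.1 (eventually_supportFun_between h hL hδ0)
    refine ⟨N, fun i hi => ?_⟩
    have hb := hN i hi.le
    have hpos := orliczNorm_pos (μs i) hφ hL
    have h1 := orliczNorm_le_mul (μs i) hφ (hK i) hL (by linarith) fun u => (hb u).2
    have hδ' : 0 < 1 - δ := by linarith
    have h2 := orliczNorm_le_mul (μs i) hφ hL (hK i) (inv_pos.2 hδ') fun u =>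
      (le_inv_mul_iff₀ hδ').2 (hb u).1
    rw [le_inv_mul_iff₀ hδ', ← le_div_iff₀ hpos] at h2
    rw [← div_le_iff₀ hpos] at h1
    rw [Real.dist_eq, abs_lt]
    constructor <;> linarith
  have := hratio.mul hy
  rw [one_mul] at this
  refine this.congr fun i => ?_
  exact div_mul_cancel₀ _ (orliczNorm_pos (μs i) hφ hL).ne'

/-! ### Closedness of the constraint -/

/-- The bodies `Q` around the origin with `∫ G(1 / h_Q(u), u) du = C`. -/
def polarLevel (G : ℝ → Sph n → ℝ) (C : ℝ) : Set (ConvexBody (Euc n)) :=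
  {Q | Q ∈ bodiesAroundOrigin n ∧
    ∫ u, G (1 / supportFun (Q : Set (Euc n)) u) u ∂(sphericalMeasure n) = C}

theorem continuous_one_div_supportFun {K : ConvexBody (Euc n)} (hK : K ∈ bodiesAroundOrigin n) :
    Continuous fun u => 1 / supportFun (K : Set (Euc n)) u :=
  continuous_const.div (continuous_supportFun K) fun u => (supportFun_pos hK u).ne'

theorem one_div_supportFun_pos {K : ConvexBody (Euc n)} (hK : K ∈ bodiesAroundOrigin n)
    (u : Sph n) : 0 < 1 / supportFun (K : Set (Euc n)) u :=
  one_div_pos.2 (supportFun_pos hK u)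

theorem luxInt_one (ν : Measure (Sph n)) (H : ℝ → Sph n → ℝ) (f : Sph n → ℝ) :
    luxInt ν H f 1 = ∫ u, H (f u) u ∂ν := by
  simp only [luxInt, div_one]

/-- The same two-sided comparison places `C` between the modular of `1 / h_L` at `1 + ε` and at `1 -
ε`; let `ε → 0`. -/
theorem ClassGI.mem_polarLevel_of_tendsto {G : ℝ → Sph n → ℝ} (hG : ClassGI G) {C : ℝ}
    {K : ℕ → ConvexBody (Euc n)} {L : ConvexBody (Euc n)} (hK : ∀ i, K i ∈ polarLevel G C)
    (hL : L ∈ bodiesAroundOrigin n) (h : Tendsto K atTop (𝓝 L)) : L ∈ polarLevel G C := by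
  refine ⟨hL, ?_⟩
  have hc := continuous_one_div_supportFun hL
  have hp := one_div_supportFun_pos hL
  set I := luxInt (sphericalMeasure n) G fun u => 1 / supportFun (L : Set (Euc n)) u with hI
  have hIc : ContinuousAt I 1 :=
    (hG.luxInt_continuousOn _ hc hp).continuousAt (Ioi_mem_nhds one_pos)
  have hplus : Tendsto (fun ε : ℝ => I (1 + ε)) (𝓝[>] 0) (𝓝 (I 1)) := by
    refine hIc.tendsto.comp (Tendsto.mono_left ?_ nhdsWithin_le_nhds)
    exact (by fun_prop : Continuous fun x : ℝ => 1 + x).tendsto' 0 1 (by simp)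
  have hminus : Tendsto (fun ε : ℝ => I (1 - ε)) (𝓝[>] 0) (𝓝 (I 1)) := by
    refine hIc.tendsto.comp (Tendsto.mono_left ?_ nhdsWithin_le_nhds)
    exact (by fun_prop : Continuous fun x : ℝ => 1 - x).tendsto' 0 1 (by simp)
  have hsmall : ∀ᶠ ε : ℝ in 𝓝[>] 0, 0 < ε ∧ ε < 1 :=
    Ioo_mem_nhdsGT one_pos
  rw [← luxInt_one]
  apply le_antisymm
  · refine le_of_tendsto hplus (hsmall.mono fun ε hε => ?_)
    obtain ⟨i, hi⟩ := (eventually_supportFun_between h hL hε.1).exists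
    rw [← (hK i).2]
    refine hG.integral_mono _ (hc.div_const _) (continuous_one_div_supportFun (hK i).1)
      (fun u => div_pos (hp u) (by linarith [hε.1])) fun u => ?_
    rw [div_div, mul_comm]
    exact one_div_le_one_div_of_le (supportFun_pos (hK i).1 u) (hi u).2
  · refine ge_of_tendsto hminus (hsmall.mono fun ε hε => ?_)
    obtain ⟨i, hi⟩ := (eventually_supportFun_between h hL hε.1).exists
    have hε' : 0 < 1 - ε := by linarith [hε.2]
    rw [← (hK i).2]
    refine hG.integral_mono _ (continuous_one_div_supportFun (hK i).1) (hc.div_const _)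
      (one_div_supportFun_pos (hK i).1) fun u => ?_
    rw [div_div, mul_comm]
    exact one_div_le_one_div_of_le (mul_pos hε' (supportFun_pos hL u)) (hi u).1

theorem ClassGI.mem_bodiesAroundOrigin_of_tendsto (hn : 1 ≤ n) {G : ℝ → Sph n → ℝ}
    (hG : ClassGI G) {q c T R C : ℝ} (hq : (n : ℝ) - 1 ≤ q) (hc : 0 < c)
    (hGq : ∀ t, T ≤ t → ∀ u, c * t ^ q ≤ G t u)
    {K : ℕ → ConvexBody (Euc n)} {L : ConvexBody (Euc n)} (hK : ∀ i, K i ∈ polarLevel G C)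
    (hR : ∀ i, ∀ x ∈ K i, ‖x‖ ≤ R) (h : Tendsto K atTop (𝓝 L)) : L ∈ bodiesAroundOrigin n := by
  refine mem_bodiesAroundOrigin fun v => ?_
  by_contra hv
  have hlim := tendsto_supportFun h v
  have h0 : supportFun (L : Set (Euc n)) v = 0 :=
    le_antisymm (not_lt.1 hv) (ge_of_tendsto' hlim fun i => (supportFun_pos (hK i).1 v).le)
  rw [h0] at hlim
  refine hG.not_bounded_of_tendsto_zero hn (R := max R 1) (T := T) hq hc (by positivity) hGq
    (fun i => continuous_supportFun (K i)) (fun i => supportFun_pos (hK i).1)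
    (fun i u => supportFun_le_add (fun x hx => (hR i x hx).trans (le_max_left _ _)) u v) hlim
    fun i => (hK i).2.le

/-! ### Boundedness from non-concentration -/

theorem NotConcentratedOnHemisphere.neZero (hn : 1 ≤ n) {μ : FiniteMeasure (Sph n)}
    (hμ : NotConcentratedOnHemisphere μ) : NeZero (μ : Measure (Sph n)) := by
  have : Nonempty (Fin n) := ⟨⟨0, hn⟩⟩
  obtain ⟨v⟩ : Nonempty (Sph n) := NormedSpace.sphere_nonempty.2 zero_le_one |>.to_subtype
  refine ⟨fun h => ?_⟩
  have := hμ v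
  rw [h] at this
  simp at this

theorem NotConcentratedOnHemisphere.integral_pos {μ : FiniteMeasure (Sph n)}
    (hμ : NotConcentratedOnHemisphere μ) (v : Sph n) :
    0 < ∫ u : Sph n, max 0 (inner ℝ (u : Euc n) (v : Euc n)) ∂(μ : Measure (Sph n)) := by
  have hc : Continuous fun u : Sph n => max 0 (inner ℝ (u : Euc n) (v : Euc n)) := by fun_prop
  rw [integral_pos_iff_support_of_nonneg
    (f := fun u : Sph n => max 0 (inner ℝ (u : Euc n) (v : Euc n))) (fun u => le_max_left _ _)
    (hc.integrable_of_hasCompactSupport (HasCompactSupport.of_compactSpace _))]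
  refine (hμ v).trans_le (measure_mono fun u hu => ?_)
  have hu' : 0 < inner ℝ (u : Euc n) (v : Euc n) := not_le.1 fun h => hu h
  exact (lt_max_of_lt_right hu').ne'

theorem exists_norm_smul_eq [Nonempty (Sph n)] (x : Euc n) :
    ∃ v : Sph n, ‖x‖ • (v : Euc n) = x := by
  by_cases hx : x = 0
  · exact ⟨Classical.arbitrary _, by simp [hx]⟩
  · exact ⟨⟨‖x‖⁻¹ • x, by simp [norm_smul, hx]⟩, smul_inv_smul₀ (norm_ne_zero_iff.2 hx) x⟩

/-- Otherwise the longest vectors `x i = ‖x i‖ • w i` of `K i` have norms tending to infinity, with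
`w i → v` along a subsequence. Then `h_{K i}(u) ≥ ‖x i‖ δ / 2` wherever `⟨u, v⟩ > δ`, a region of
positive `μ`-measure, so the modular at `l` blows up. -/
theorem exists_frequently_norm_le (hn : 1 ≤ n) {μs : ℕ → FiniteMeasure (Sph n)}
    {μ : FiniteMeasure (Sph n)} [∀ i, NeZero (μs i : Measure (Sph n))]
    (hμ : NotConcentratedOnHemisphere μ) (hweak : Tendsto μs atTop (𝓝 μ)) {φ : ℝ → ℝ}
    (hφ : ClassI φ) {K : ℕ → ConvexBody (Euc n)} (hK : ∀ i, K i ∈ bodiesAroundOrigin n) {l : ℝ}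
    (hl : ∀ᶠ i in atTop, orliczNorm (μs i) φ (K i) ≤ l) :
    ∃ R : ℝ, ∃ᶠ i in atTop, ∀ x ∈ K i, ‖x‖ ≤ R := by
  by_contra! hunb
  have : NeZero (μ : Measure (Sph n)) := hμ.neZero hn
  have : Nonempty (Fin n) := ⟨⟨0, hn⟩⟩
  have : Nonempty (Sph n) := NormedSpace.sphere_nonempty.2 zero_le_one |>.to_subtype
  have hl0 : 0 < l := by
    obtain ⟨i, hi⟩ := hl.exists
    exact (orliczNorm_pos (μs i) hφ (hK i)).trans_le hi
  choose x hxK hxmax using fun i =>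
    (K i).isCompact.exists_isMaxOn (K i).nonempty (f := fun x => ‖x‖) continuous_norm.continuousOn
  have hr : Tendsto (fun i => ‖x i‖) atTop atTop := by
    refine tendsto_atTop.2 fun R => ?_
    filter_upwards [hunb R] with i hi
    obtain ⟨y, hy, hRy⟩ := hi
    exact hRy.le.trans (hxmax i hy)
  choose w hw using fun i => exists_norm_smul_eq (x i)
  obtain ⟨v, k, hk, hkv⟩ := CompactSpace.tendsto_subseq w
  have ha := hμ.integral_pos v
  set a := ∫ u : Sph n, max 0 (inner ℝ (u : Euc n) (v : Euc n)) ∂(μ : Measure (Sph n)) with ha_def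
  have hm := mass_pos μ
  -- Half the mean of the positive part of `⟨u, v⟩`, so that subtracting `δ` still leaves an
  -- integral of at least `a / 2`.
  set δ : ℝ := a / (2 * (μ.mass : ℝ)) with hδ
  have hδ0 : 0 < δ := by positivity
  -- A continuous minorant of the indicator of `{⟨u, v⟩ > δ}`, to which weak convergence applies
  -- directly.
  set g : Sph n → ℝ := fun u => max 0 (inner ℝ (u : Euc n) (v : Euc n) - δ) with hg
  have hgc : Continuous g := by fun_prop
  have hint : ∀ {f : Sph n → ℝ} (ν : FiniteMeasure (Sph n)), Continuous f →
      Integrable f (ν : Measure (Sph n)) := fun ν hf =>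
    hf.integrable_of_hasCompactSupport (HasCompactSupport.of_compactSpace _)
  have hgpos : 0 < ∫ u, g u ∂(μ : Measure (Sph n)) := by
    have h1 : a - δ * (μ.mass : ℝ) ≤ ∫ u, g u ∂(μ : Measure (Sph n)) := by
      calc a - δ * (μ.mass : ℝ)
          = ∫ u : Sph n, (max 0 (inner ℝ (u : Euc n) (v : Euc n)) - δ)
              ∂(μ : Measure (Sph n)) := by
            rw [integral_sub (hint μ (by fun_prop)) (integrable_const _), integral_const,
              smul_eq_mul, mul_comm δ]
            rfl
        _ ≤ _ := by
            refine integral_mono (hint μ (by fun_prop)) (hint μ hgc) fun u => ?_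
            simp only [hg]
            rcases le_total (inner ℝ (u : Euc n) (v : Euc n)) 0 with h | h
            · rw [max_eq_left h]
              exact le_max_of_le_left (by linarith)
            · rw [max_eq_right h]
              exact le_max_right _ _
    have h2 : δ * (μ.mass : ℝ) = a / 2 := by rw [hδ]; field_simp
    linarith
  have hgle : ∀ u, g u ≤ 1 := fun u => max_le zero_le_one (by
    have := real_inner_le_norm (u : Euc n) (v : Euc n)
    rw [norm_eq_of_mem_sphere u, norm_eq_of_mem_sphere v] at this
    linarith)
  have hweak' : Tendsto (μs ∘ k) atTop (𝓝 μ) := hweak.comp hk.tendsto_atTop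
  have hbig : Tendsto (fun j => φ (‖x (k j)‖ * (δ / 2) / l) *
      ∫ u, g u ∂(μs (k j) : Measure (Sph n))) atTop atTop := by
    refine Tendsto.atTop_mul_pos hgpos (hφ.tendsto_atTop.comp ?_)
      (tendsto_integral_of_continuous hweak' hgc)
    exact ((hr.comp hk.tendsto_atTop).atTop_mul_const (half_pos hδ0)).atTop_div_const hl0
  have hev := (hkv.eventually (Metric.ball_mem_nhds v (half_pos hδ0))).and
    ((hk.tendsto_atTop.eventually hl).and (((hr.comp hk.tendsto_atTop).eventually_gt_atTop 0).and
    ((hbig.eventually_gt_atTop ((μ.mass : ℝ) + 1)).and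
      ((tendsto_mass_coe hweak').eventually_lt_const (lt_add_one _)))))
  obtain ⟨j, hj1, hj2, hj3, hj4, hj5⟩ := hev.exists
  have hKc := continuous_supportFun (K (k j))
  have hKp := supportFun_pos (hK (k j))
  have hmj := mass_pos (μs (k j))
  rw [orliczNorm_eq_lux, (hφ.classGI (μs (k j))).lux_le_iff _ hKc hKp hl0] at hj2
  simp only [luxInt, integral_const_mul] at hj2
  rw [one_div, inv_mul_le_iff₀ hmj, mul_one] at hj2
  have hφc : Continuous fun u => φ (supportFun (K (k j) : Set (Euc n)) u / l) :=
    hφ.continuousOn.comp_continuous (hKc.div_const _) fun u => div_pos (hKp u) hl0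
  have hlow : φ (‖x (k j)‖ * (δ / 2) / l) * ∫ u, g u ∂(μs (k j) : Measure (Sph n)) ≤
      ∫ u, φ (supportFun (K (k j) : Set (Euc n)) u / l) ∂(μs (k j) : Measure (Sph n)) := by
    rw [← integral_const_mul]
    refine integral_mono (hint _ (hgc.const_mul _)) (hint _ hφc) fun u => ?_
    have hxpos : 0 < ‖x (k j)‖ * (δ / 2) / l :=
      div_pos (mul_pos hj3 (half_pos hδ0)) hl0
    rcases le_or_gt (inner ℝ (u : Euc n) (v : Euc n)) δ with h | h
    · simp only [hg]
      rw [max_eq_left (by linarith), mul_zero]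
      exact (hφ.pos _ (div_pos (hKp u) hl0)).le
    · refine (mul_le_of_le_one_right (hφ.pos _ hxpos).le (hgle u)).trans ?_
      refine hφ.strictMonoOn.monotoneOn hxpos (div_pos (hKp u) hl0) ?_
      refine div_le_div_of_nonneg_right (le_trans ?_ (inner_le_supportFun (hxK (k j)) u)) hl0.le
      rw [← hw (k j), real_inner_smul_left, hw (k j)]
      refine mul_le_mul_of_nonneg_left ?_ (norm_nonneg _)
      have h1 : inner ℝ (w (k j) : Euc n) (u : Euc n) = inner ℝ (u : Euc n) (v : Euc n) -
          inner ℝ (u : Euc n) ((v : Euc n) - w (k j)) := by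
        rw [inner_sub_right, real_inner_comm (u : Euc n) (w (k j) : Euc n)]; ring
      have h2 := real_inner_le_norm (u : Euc n) ((v : Euc n) - w (k j))
      rw [norm_eq_of_mem_sphere u, one_mul, ← dist_eq_norm, dist_comm] at h2
      have h3 : dist (w (k j) : Euc n) v < δ / 2 := hj1
      linarith
  exact absurd (hj4.trans_le (hlow.trans hj2)) hj5.not_gt

/-! ### Compactness and uniqueness of solutions -/

theorem ClassGI.exists_subseq_tendsto_solution (hn : 1 ≤ n) {μs : ℕ → FiniteMeasure (Sph n)}
    {μ : FiniteMeasure (Sph n)} [∀ i, NeZero (μs i : Measure (Sph n))]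
    (hμ : NotConcentratedOnHemisphere μ) (hweak : Tendsto μs atTop (𝓝 μ))
    {G : ℝ → Sph n → ℝ} (hG : ClassGI G) {q c T C : ℝ} (hq : (n : ℝ) - 1 ≤ q) (hc : 0 < c)
    (hGq : ∀ t, T ≤ t → ∀ u, c * t ^ q ≤ G t u) {φ : ℝ → ℝ} (hφ : ClassI φ)
    {K : ℕ → ConvexBody (Euc n)} {M : ConvexBody (Euc n)}
    (hK : ∀ i, IsSolution (μs i) φ (polarLevel G C) (K i))
    (hM : IsSolution μ φ (polarLevel G C) M) :
    ∃ (k : ℕ → ℕ) (L : ConvexBody (Euc n)), IsSolution μ φ (polarLevel G C) L ∧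
      Tendsto (K ∘ k) atTop (𝓝 L) ∧
      Tendsto (fun i => orliczNorm (μs (k i)) φ (K (k i))) atTop (𝓝 (orliczNorm μ φ M)) := by
  have : NeZero (μ : Measure (Sph n)) := hμ.neZero hn
  have hMlim := tendsto_orliczNorm_const hweak hφ hM.1.1
  have hle : ∀ i, orliczNorm (μs i) φ (K i) ≤ orliczNorm (μs i) φ M := fun i => (hK i).2 M hM.1
  obtain ⟨R, hR⟩ := exists_frequently_norm_le hn hμ hweak hφ (fun i => (hK i).1.1)
    (l := orliczNorm μ φ M + 1)
    ((hMlim.eventually_lt_const (lt_add_one _)).mono fun i hi => (hle i).trans hi.le)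
  obtain ⟨k₁, hk₁, hb⟩ := extraction_of_frequently_atTop hR
  obtain ⟨L, k₂, hk₂, hlim⟩ := exists_subseq_tendsto_convexBody (K ∘ k₁) hb
  have hkt : Tendsto (k₁ ∘ k₂) atTop atTop := hk₁.tendsto_atTop.comp hk₂.tendsto_atTop
  have hL0 : L ∈ bodiesAroundOrigin n :=
    hG.mem_bodiesAroundOrigin_of_tendsto hn hq hc hGq (fun i => (hK (k₁ (k₂ i))).1)
      (fun i => hb (k₂ i)) hlim
  have hL : L ∈ polarLevel G C :=
    hG.mem_polarLevel_of_tendsto (fun i => (hK (k₁ (k₂ i))).1) hL0 hlim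
  have hnorm := tendsto_orliczNorm (μs := fun i => μs (k₁ (k₂ i))) (hweak.comp hkt) hφ
    (fun i => (hK (k₁ (k₂ i))).1.1) hL0 hlim
  -- One inequality passes `‖K i‖ ≤ ‖M‖` to the limit; the other uses `L` as a competitor for `μ`.
  have hLM : orliczNorm μ φ L = orliczNorm μ φ M :=
    le_antisymm (le_of_tendsto_of_tendsto' hnorm (hMlim.comp hkt) fun i => hle _) (hM.2 L hL)
  rw [hLM] at hnorm
  exact ⟨k₁ ∘ k₂, L, ⟨hL, fun Q hQ => hLM.le.trans (hM.2 Q hQ)⟩, hlim, hnorm⟩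

theorem map_half_add_half_le_of_convexOn {f : ℝ → ℝ} (hf : ConvexOn ℝ (Set.Ioi 0) f) {a b : ℝ}
    (ha : 0 < a) (hb : 0 < b) : f ((a + b) / 2) ≤ (f a + f b) / 2 := by
  have := hf.2 (Set.mem_Ioi.2 ha) (Set.mem_Ioi.2 hb) (by norm_num : (0 : ℝ) ≤ 1 / 2)
    (by norm_num : (0 : ℝ) ≤ 1 / 2) (by norm_num)
  simp only [smul_eq_mul] at this
  calc f ((a + b) / 2) = f (1 / 2 * a + 1 / 2 * b) := by ring_nf
    _ ≤ _ := this
    _ = _ := by ring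

theorem one_div_half_add_le {a b : ℝ} (ha : 0 < a) (hb : 0 < b) :
    1 / ((a + b) / 2) ≤ (1 / a + 1 / b) / 2 := by
  rw [← sub_nonneg]
  have : (1 / a + 1 / b) / 2 - 1 / ((a + b) / 2) = (a - b) ^ 2 / (2 * a * b * (a + b)) := by
    field_simp; ring
  rw [this]; positivity

theorem one_div_half_add_lt {a b : ℝ} (ha : 0 < a) (hb : 0 < b) (hab : a ≠ b) :
    1 / ((a + b) / 2) < (1 / a + 1 / b) / 2 := by
  rw [← sub_pos]
  have : (1 / a + 1 / b) / 2 - 1 / ((a + b) / 2) = (a - b) ^ 2 / (2 * a * b * (a + b)) := by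
    field_simp; ring
  have h : a - b ≠ 0 := sub_ne_zero.2 hab
  rw [this]; positivity

/-- The midpoint `Q` of two solutions has norm at most the common minimum, by convexity of `φ`. Its
dual volume is strictly below `C` if they differ, because `1 / x` is strictly convex and `G`
strictly increasing; neither `φ` nor `G` needs strict convexity. Shrinking `Q` restores the
constraint and lowers the norm. -/
theorem ClassGI.solution_unique [NeZero (sphericalMeasure n)] {μ : FiniteMeasure (Sph n)}
    [NeZero (μ : Measure (Sph n))] {G : ℝ → Sph n → ℝ} (hG : ClassGI G) {φ : ℝ → ℝ}
    (hφ : ClassI φ) (hφc : ConvexOn ℝ (Set.Ioi 0) φ)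
    (hGc : ∀ u, ConvexOn ℝ (Set.Ioi 0) fun t => G t u) {C : ℝ} {K L : ConvexBody (Euc n)}
    (hK : IsSolution μ φ (polarLevel G C) K) (hL : IsSolution μ φ (polarLevel G C) L) :
    K = L := by
  by_contra hne
  obtain ⟨u₀, hu₀⟩ : ∃ u, supportFun (K : Set (Euc n)) u ≠ supportFun (L : Set (Euc n)) u := by
    by_contra! h
    exact hne (eq_of_supportFun_eq h)
  have hKp := supportFun_pos hK.1.1
  have hLp := supportFun_pos hL.1.1
  set Q : ConvexBody (Euc n) := (1 / 2 : ℝ) • (K + L) with hQ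
  have hQh : ∀ u, supportFun (Q : Set (Euc n)) u =
      (supportFun (K : Set (Euc n)) u + supportFun (L : Set (Euc n)) u) / 2 := fun u => by
    rw [hQ, supportFun_smul _ (by norm_num), supportFun_add]; ring
  have hQ0 : Q ∈ bodiesAroundOrigin n := mem_bodiesAroundOrigin fun u => by
    rw [hQh]; linarith [hKp u, hLp u]
  have hQp := supportFun_pos hQ0
  have hcont : ∀ {A : ConvexBody (Euc n)}, A ∈ bodiesAroundOrigin n →
      Continuous fun u => G (1 / supportFun (A : Set (Euc n)) u) u := fun hA =>
    hG.continuous_comp (continuous_one_div_supportFun hA) continuous_id (one_div_supportFun_pos hA)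
  have hint : ∀ {A : ConvexBody (Euc n)}, A ∈ bodiesAroundOrigin n →
      Integrable (fun u => G (1 / supportFun (A : Set (Euc n)) u) u) (sphericalMeasure n) :=
    fun hA => hG.integrable _ (continuous_one_div_supportFun hA) (one_div_supportFun_pos hA)
  have hmid : ∀ u, G ((1 / supportFun (K : Set (Euc n)) u + 1 / supportFun (L : Set (Euc n)) u) / 2)
      u ≤ (G (1 / supportFun (K : Set (Euc n)) u) u +
        G (1 / supportFun (L : Set (Euc n)) u) u) / 2 := fun u =>
    map_half_add_half_le_of_convexOn (hGc u) (one_div_pos.2 (hKp u)) (one_div_pos.2 (hLp u))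
  have hlt : ∫ u, G (1 / supportFun (Q : Set (Euc n)) u) u ∂(sphericalMeasure n) < C := by
    have hpos : 0 < ∫ u, ((G (1 / supportFun (K : Set (Euc n)) u) u +
        G (1 / supportFun (L : Set (Euc n)) u) u) / 2 -
        G (1 / supportFun (Q : Set (Euc n)) u) u) ∂(sphericalMeasure n) := by
      refine Continuous.integral_pos_of_hasCompactSupport_nonneg_nonzero (x := u₀)
        ((((hcont hK.1.1).add (hcont hL.1.1)).div_const 2).sub (hcont hQ0))
        (HasCompactSupport.of_compactSpace _) (fun u => sub_nonneg.2 ?_) (sub_pos.2 ?_).ne'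
      · refine le_trans (hG.mono (one_div_supportFun_pos hQ0 u) ?_ u) (hmid u)
        rw [hQh]
        exact one_div_half_add_le (hKp u) (hLp u)
      · refine lt_of_lt_of_le (hG.strictMonoOn u₀ (one_div_supportFun_pos hQ0 u₀) ?_ ?_) (hmid u₀)
        · have h1 := one_div_pos.2 (hKp u₀)
          have h2 := one_div_pos.2 (hLp u₀)
          exact half_pos (add_pos h1 h2)
        · rw [hQh]
          exact one_div_half_add_lt (hKp u₀) (hLp u₀) hu₀
    have hsum : Integrable (fun u => (G (1 / supportFun (K : Set (Euc n)) u) u +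
        G (1 / supportFun (L : Set (Euc n)) u) u) / 2) (sphericalMeasure n) :=
      ((hint hK.1.1).add (hint hL.1.1)).div_const 2
    rw [integral_sub hsum (hint hQ0),
      integral_div, integral_add (hint hK.1.1) (hint hL.1.1), hK.1.2, hL.1.2] at hpos
    linarith
  have hC : 0 < C := (integral_nonneg fun u =>
    (hG.pos _ (one_div_supportFun_pos hQ0 u) u).le).trans_lt hlt
  -- Passing from `Q` to `τ • Q` replaces `1 / h_Q` by `1 / (τ h_Q)`, so the modular parameter is
  -- the dilation factor.
  obtain ⟨τ, hτ, hτC⟩ := hG.exists_luxInt_eq (sphericalMeasure n)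
    (continuous_one_div_supportFun hQ0) (one_div_supportFun_pos hQ0) hC
  have hτ1 : τ < 1 := by
    rw [← luxInt_one, ← hτC] at hlt
    exact ((hG.luxInt_strictAntiOn _ (continuous_one_div_supportFun hQ0)
      (one_div_supportFun_pos hQ0)).lt_iff_gt (Set.mem_Ioi.2 one_pos) hτ).1 hlt
  have hPh : ∀ u, supportFun ((τ • Q : ConvexBody (Euc n)) : Set (Euc n)) u =
      τ * supportFun (Q : Set (Euc n)) u := supportFun_smul Q hτ.le
  have hP0 : τ • Q ∈ bodiesAroundOrigin n := mem_bodiesAroundOrigin fun u => by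
    rw [hPh]; exact mul_pos hτ (hQp u)
  have hP : τ • Q ∈ polarLevel G C := by
    refine ⟨hP0, ?_⟩
    rw [← hτC, luxInt]
    refine integral_congr_ae (Eventually.of_forall fun u => ?_)
    simp only [hPh, div_div, mul_comm]
  have hnormP := orliczNorm_le_mul μ hφ hP0 hQ0 hτ fun u => (hPh u).le
  have hKL : orliczNorm μ φ L = orliczNorm μ φ K :=
    le_antisymm (hL.2 K hK.1) (hK.2 L hL.1)
  have hl := orliczNorm_pos μ hφ hK.1.1
  have hH := hφ.classGI μ
  have hnormQ : orliczNorm μ φ Q ≤ orliczNorm μ φ K := by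
    have hK1 := (hH.lux_spec (μ : Measure (Sph n)) (continuous_supportFun K) hKp).2
    have hL1 := (hH.lux_spec (μ : Measure (Sph n)) (continuous_supportFun L) hLp).2
    rw [← orliczNorm_eq_lux] at hK1 hL1
    rw [hKL] at hL1
    rw [orliczNorm_eq_lux μ φ Q, hH.lux_le_iff _ (continuous_supportFun Q) hQp hl]
    set l := orliczNorm μ φ K
    have hi : ∀ {A : ConvexBody (Euc n)}, A ∈ bodiesAroundOrigin n →
        Integrable (fun u => 1 / (μ.mass : ℝ) * φ (supportFun (A : Set (Euc n)) u / l)) μ :=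
      fun hA => hH.integrable _ ((continuous_supportFun _).div_const l)
        fun u => div_pos (supportFun_pos hA u) hl
    have hmean : luxInt μ (fun t _ => 1 / (μ.mass : ℝ) * φ t) (supportFun (Q : Set (Euc n))) l ≤
        ∫ u, (1 / (μ.mass : ℝ) * φ (supportFun (K : Set (Euc n)) u / l) +
          1 / (μ.mass : ℝ) * φ (supportFun (L : Set (Euc n)) u / l)) / 2
          ∂(μ : Measure (Sph n)) := by
      refine MeasureTheory.integral_mono (hi hQ0) (((hi hK.1.1).add (hi hL.1.1)).div_const 2) fun u => ?_
      have h1 := map_half_add_half_le_of_convexOn hφc (div_pos (hKp u) hl) (div_pos (hLp u) hl)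
      have h2 := mul_le_mul_of_nonneg_left h1 (one_div_pos.2 (mass_pos μ)).le
      have h3 : supportFun (Q : Set (Euc n)) u / l = (supportFun (K : Set (Euc n)) u / l +
          supportFun (L : Set (Euc n)) u / l) / 2 := by rw [hQh]; ring
      simp only [h3]
      linarith
    rw [integral_div, integral_add (hi hK.1.1) (hi hL.1.1)] at hmean
    have hK1' : ∫ u, 1 / (μ.mass : ℝ) * φ (supportFun (K : Set (Euc n)) u / l)
      ∂(μ : Measure (Sph n)) = 1 := hK1
    have hL1' : ∫ u, 1 / (μ.mass : ℝ) * φ (supportFun (L : Set (Euc n)) u / l)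
      ∂(μ : Measure (Sph n)) = 1 := hL1
    rw [hK1', hL1'] at hmean
    linarith
  have h1 := hK.2 _ hP
  have h2 := mul_le_mul_of_nonneg_left hnormQ hτ.le
  have h3 := mul_lt_mul_of_pos_right hτ1 hl
  linarith

/-- Continuity of the solutions of the general dual polar problem in the measure. -/
theorem ClassGI.tendsto_solution (hn : 1 ≤ n) {μs : ℕ → FiniteMeasure (Sph n)}
    {μ : FiniteMeasure (Sph n)} [∀ i, NeZero (μs i : Measure (Sph n))]
    (hμ : NotConcentratedOnHemisphere μ) (hweak : Tendsto μs atTop (𝓝 μ))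
    {G : ℝ → Sph n → ℝ} (hG : ClassGI G) {q c T C : ℝ} (hq : (n : ℝ) - 1 ≤ q) (hc : 0 < c)
    (hGq : ∀ t, T ≤ t → ∀ u, c * t ^ q ≤ G t u) {φ : ℝ → ℝ} (hφ : ClassI φ)
    {K : ℕ → ConvexBody (Euc n)} {M : ConvexBody (Euc n)}
    (hK : ∀ i, IsSolution (μs i) φ (polarLevel G C) (K i))
    (hM : IsSolution μ φ (polarLevel G C) M) :
    Tendsto (fun i => orliczNorm (μs i) φ (K i)) atTop (𝓝 (orliczNorm μ φ M)) ∧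
      (ConvexOn ℝ (Set.Ioi 0) φ → (∀ u, ConvexOn ℝ (Set.Ioi 0) fun t => G t u) →
        Tendsto K atTop (𝓝 M)) := by
  have : NeZero (μ : Measure (Sph n)) := hμ.neZero hn
  have : Nonempty (Fin n) := ⟨⟨0, hn⟩⟩
  have : NeZero (sphericalMeasure n) := ⟨Measure.toSphere_ne_zero _⟩
  -- It suffices that every subsequence has a further subsequence with the right limit. For bodies,
  -- uniqueness identifies that limit with `M`.
  refine ⟨tendsto_of_subseq_tendsto fun ns hns => ?_, fun hφc hGc =>
    tendsto_of_subseq_tendsto fun ns hns => ?_⟩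
  · obtain ⟨k, L, -, -, h⟩ := hG.exists_subseq_tendsto_solution hn (μs := fun i => μs (ns i)) hμ
      (hweak.comp hns) hq hc hGq hφ (fun i => hK (ns i)) hM
    exact ⟨k, h⟩
  · obtain ⟨k, L, hL, h, -⟩ := hG.exists_subseq_tendsto_solution hn (μs := fun i => μs (ns i)) hμ
      (hweak.comp hns) hq hc hGq hφ (fun i => hK (ns i)) hM
    rw [hG.solution_unique hφ hφc hGc hL hM] at h
    exact ⟨k, h⟩

/-! ### Reduction of both problems to a level set -/

theorem GrowthCondition.exists_mul_rpow_le {G : ℝ → Sph n → ℝ} (hG : ClassGI G) {q : ℝ}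
    (hGq : GrowthCondition G q) : ∃ c : ℝ, 0 < c ∧ ∀ t, 1 ≤ t → ∀ u, c * t ^ q ≤ G t u := by
  refine ⟨_, hGq, fun t ht u => ?_⟩
  have ht0 : 0 < t := one_pos.trans_le ht
  rw [← le_div_iff₀ (Real.rpow_pos_of_pos ht0 q)]
  refine csInf_le ⟨0, ?_⟩ ⟨t, u, ht, rfl⟩
  rintro x ⟨s, w, hs, rfl⟩
  have hs0 : 0 < s := one_pos.trans_le hs
  exact (div_pos (hG.pos s hs0 w) (Real.rpow_pos_of_pos hs0 q)).le

theorem ClassGI.comp_div {G : ℝ → Sph n → ℝ} (hG : ClassGI G) {η : ℝ} (hη : 0 < η) :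
    ClassGI fun t u => G (t / η) u where
  continuousOn := hG.continuousOn.comp (f := fun p : ℝ × Sph n => (p.1 / η, p.2))
    (by fun_prop) fun p hp => ⟨div_pos hp.1 hη, trivial⟩
  pos t ht u := hG.pos _ (div_pos ht hη) u
  strictMonoOn u := fun a ha b hb hab => hG.strictMonoOn u (div_pos ha hη) (div_pos hb hη)
    (div_lt_div_of_pos_right hab hη)
  tendsto_zero u := (hG.tendsto_zero u).comp (tendsto_nhdsWithin_iff.2
    ⟨((by fun_prop : Continuous fun t : ℝ => t / η).tendsto' 0 0 (by simp)).mono_left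
      nhdsWithin_le_nhds, eventually_nhdsWithin_of_forall fun t ht => div_pos ht hη⟩)
  tendsto_atTop u := (hG.tendsto_atTop u).comp (tendsto_id.atTop_div_const hη)

theorem tildeB_eq_polarLevel (G : ℝ → Sph n → ℝ) :
    tildeB G = polarLevel G (dualVolume G (Metric.closedBall 0 1)) := by
  ext Q
  refine and_congr_right fun hQ => ?_
  simp only [dualVolume, radialFun_polarSet hQ]

/-- With `η = V̂_G(Bⁿ) > 0`, the equation `V̂_G(Q°) = η` says precisely that the modular of `1 /
h_Q` at `η` is 1. -/
theorem ClassGI.hatB_eq_polarLevel [NeZero (sphericalMeasure n)] {G : ℝ → Sph n → ℝ}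
    (hG : ClassGI G) :
    ∃ η, 0 < η ∧ hatB G = polarLevel (fun t u => G (t / η) u) 1 := by
  have hB : homDualVolume G (Metric.closedBall 0 1) =
      lux (sphericalMeasure n) G (radialFun (Metric.closedBall 0 1)) := rfl
  have hone : radialFun (Metric.closedBall (0 : Euc n) 1) = fun _ => 1 :=
    funext radialFun_closedBall
  have h0 := (hG.lux_spec (sphericalMeasure n) (f := fun _ => 1) continuous_const
    fun _ => one_pos).1
  rw [← hone, ← hB] at h0
  refine ⟨_, h0, ?_⟩
  ext Q
  refine and_congr_right fun hQ => ?_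
  have hQ' : homDualVolume G (polarSet (Q : Set (Euc n))) =
      lux (sphericalMeasure n) G fun u => 1 / supportFun (Q : Set (Euc n)) u := by
    rw [← funext (radialFun_polarSet hQ)]; rfl
  have hc := continuous_one_div_supportFun hQ
  have hp := one_div_supportFun_pos hQ
  rw [hQ']
  constructor
  · intro h
    rw [← h]
    exact (hG.lux_spec _ hc hp).2
  · exact fun h => hG.lux_eq _ hc hp h0 h

end DualPolarOrlicz

theorem mainTheorem7 (n : ℕ) (hn : 1 ≤ n)
    (μs : ℕ → FiniteMeasure (DualPolarOrlicz.Sph n)) (μ : FiniteMeasure (DualPolarOrlicz.Sph n))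
    (hμs : ∀ i, DualPolarOrlicz.NotConcentratedOnHemisphere (μs i))
    (hμ : DualPolarOrlicz.NotConcentratedOnHemisphere μ)
    (hweak : Tendsto μs atTop (𝓝 μ))
    (G : ℝ → DualPolarOrlicz.Sph n → ℝ) (hG : DualPolarOrlicz.ClassGI G)
    (q : ℝ) (hq : (n : ℝ) - 1 ≤ q) (hGq : DualPolarOrlicz.GrowthCondition G q)
    (φ : ℝ → ℝ) (hφ : DualPolarOrlicz.ClassI φ) :
    (∀ (Ms : ℕ → ConvexBody (DualPolarOrlicz.Euc n)) (M : ConvexBody (DualPolarOrlicz.Euc n)),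
      (∀ i, DualPolarOrlicz.IsSolution (μs i) φ (DualPolarOrlicz.tildeB G) (Ms i)) →
      DualPolarOrlicz.IsSolution μ φ (DualPolarOrlicz.tildeB G) M →
        Tendsto (fun i => DualPolarOrlicz.orliczNorm (μs i) φ (Ms i)) atTop
          (𝓝 (DualPolarOrlicz.orliczNorm μ φ M)) ∧
        (ConvexOn ℝ (Set.Ioi 0) φ → (∀ u, ConvexOn ℝ (Set.Ioi 0) (fun t => G t u)) →
          Tendsto Ms atTop (𝓝 M))) ∧
    (∀ (Ms : ℕ → ConvexBody (DualPolarOrlicz.Euc n)) (M : ConvexBody (DualPolarOrlicz.Euc n)),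
      (∀ i, DualPolarOrlicz.IsSolution (μs i) φ (DualPolarOrlicz.hatB G) (Ms i)) →
      DualPolarOrlicz.IsSolution μ φ (DualPolarOrlicz.hatB G) M →
        Tendsto (fun i => DualPolarOrlicz.orliczNorm (μs i) φ (Ms i)) atTop
          (𝓝 (DualPolarOrlicz.orliczNorm μ φ M)) ∧
        (ConvexOn ℝ (Set.Ioi 0) φ → (∀ u, ConvexOn ℝ (Set.Ioi 0) (fun t => G t u)) →
          Tendsto Ms atTop (𝓝 M))) := by

  have : Nonempty (Fin n) := ⟨⟨0, hn⟩⟩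
  have : NeZero (DualPolarOrlicz.sphericalMeasure n) := ⟨Measure.toSphere_ne_zero _⟩
  have : ∀ i, NeZero (μs i : Measure (DualPolarOrlicz.Sph n)) := fun i => (hμs i).neZero hn
  obtain ⟨c, hc, hcG⟩ := hGq.exists_mul_rpow_le hG
  refine ⟨fun Ms M hMs hM => ?_, fun Ms M hMs hM => ?_⟩
  · rw [DualPolarOrlicz.tildeB_eq_polarLevel] at hMs hM
    exact hG.tendsto_solution hn hμ hweak hq hc hcG hφ hMs hM
  · obtain ⟨η, hη, hB⟩ := hG.hatB_eq_polarLevel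
    rw [hB] at hMs hM
    -- Rescaling moves the growth threshold from 1 to `η`, which is why the general result allows an
    -- arbitrary threshold `T`.
    have hgrowth : ∀ t, η ≤ t → ∀ u, c / η ^ q * t ^ q ≤ G (t / η) u := fun t ht u => by
      have h := hcG (t / η) ((one_le_div hη).2 ht) u
      rwa [Real.div_rpow (hη.le.trans ht) hη.le, mul_div_assoc', ← div_mul_eq_mul_div] at h
    obtain ⟨h1, h2⟩ := (hG.comp_div hη).tendsto_solution hn hμ hweak hq
      (div_pos hc (Real.rpow_pos_of_pos hη q)) hgrowth hφ hMs hM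
    -- Convexity of `G(·, u)` survives the linear substitution `t ↦ t / η`.
    refine ⟨h1, fun hφc hGc => h2 hφc fun u => ⟨convex_Ioi 0, fun x hx y hy a b ha hb hab => ?_⟩⟩
    have h := (hGc u).2 (div_pos hx hη) (div_pos hy hη) ha hb hab
    simpa only [smul_eq_mul, mul_div_assoc', ← add_div] using h
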